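/- Let $M$ be a smooth manifold without boundary, of dimension $n\ge 4$, with a smooth Riemannian metric $g=\langle\cdot,\cdot\rangle$ (not necessarily complete), Levi-Civita connection $D$, Ricci tensor $r_g$, scalar curvature $s_g$ and Weyl curvature tensor $\mathcal W$. Let $f$ be a smooth function on $M$ and $\rho$ a real constant such that $(M,g,f)$ is a gradient Ricci soliton, that is, $r_g + Ddf = \rho g$ on $M$. Suppose that the Weyl tensor is weakly harmonic, that is, $\delta\mathcal W(\cdot,\cdot,\nabla f)=0$, where $$\delta\mathcal W(X,Y,Z) = -\sum_{i=1}^n (D_{e_i}\mathcal W)(e_i,X,Y,Z)$$ for an orthonormal basis $(e_i)$ of the tangent space. Then $s_g$ is differentiable and its gradient is parallel to that of $f$: at every point and for every tangent vector $X$ at that point, $$\langle\nabla s_g,X\rangle\,\nabla f = \langle\nabla f,X\rangle\,\nabla s_g .$$ Consequently, at every point where $\nabla f\neq 0$, $$\nabla s_g = 2\alpha\,\nabla f,\qquad \alpha = r_g(N,N),\quad N=\frac{\nabla f}{|\nabla f|}.$$ -/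

import Mathlib

open Bundle FiberBundle VectorField Manifold
open scoped ContDiff

noncomputable section RiemannianGeometry

variable {E : Type*} [NormedAddCommGroup E] [NormedSpace ℝ E]
  {H : Type*} [TopologicalSpace H] (I : ModelWithCorners ℝ E H)
  {M : Type*} [TopologicalSpace M] [ChartedSpace H M] [IsManifold I ∞ M]
  [RiemannianBundle (fun x : M ↦ TangentSpace I x)]

/-- The right-hand side of the Koszul formula,
`½ (X⟨Y,Z⟩ + Y⟨X,Z⟩ - Z⟨X,Y⟩ + ⟨[X,Y],Z⟩ - ⟨[X,Z],Y⟩ - ⟨[Y,Z],X⟩)`, at the point `x`. -/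
def koszul (X Y Z : Π x : M, TangentSpace I x) (x : M) : ℝ :=
  (1 / 2 : ℝ) * (mvfderiv I (fun y ↦ inner ℝ (Y y) (Z y)) x (X x)
    + mvfderiv I (fun y ↦ inner ℝ (X y) (Z y)) x (Y x)
    - mvfderiv I (fun y ↦ inner ℝ (X y) (Y y)) x (Z x)
    + inner ℝ (mlieBracket I X Y x) (Z x)
    - inner ℝ (mlieBracket I X Z x) (Y x)
    - inner ℝ (mlieBracket I Y Z x) (X x))

variable {I} [FiniteDimensional ℝ E]
  [IsContMDiffRiemannianBundle I ∞ E (fun x : M ↦ TangentSpace I x)]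

theorem mdifferentiableAt_inner {x : M} {X Y : Π x : M, TangentSpace I x}
    (hX : MDiffAt (T% X) x) (hY : MDiffAt (T% Y) x) :
    MDiffAt (fun y ↦ inner ℝ (X y) (Y y)) x :=
  MDifferentiableAt.inner_bundle (IB := I) (F := E) (E := fun x : M ↦ TangentSpace I x)
    (b := fun y : M ↦ y) hX hY

theorem koszul_tensorial_left {x : M} {Y Z : Π x : M, TangentSpace I x}
    (hY : MDiffAt (T% Y) x) (hZ : MDiffAt (T% Z) x) :
    TensorialAt I E (koszul I · Y Z x) x where
  smul {f X} hf hX := by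
    have : CompleteSpace E := FiniteDimensional.complete ℝ E
    have h1 : (fun y ↦ inner ℝ ((f • X) y) (Z y)) = f * (fun y ↦ inner ℝ (X y) (Z y)) := by
      ext y; simp [inner_smul_left]
    have h2 : (fun y ↦ inner ℝ ((f • X) y) (Y y)) = f * (fun y ↦ inner ℝ (X y) (Y y)) := by
      ext y; simp [inner_smul_left]
    simp only [koszul, h1, h2]
    rw [mvfderiv_mul hf (mdifferentiableAt_inner hX hZ), mvfderiv_mul hf (mdifferentiableAt_inner hX hY),
      mlieBracket_smul_left hf hX, mlieBracket_smul_left hf hX]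
    simp [inner_add_left, inner_smul_left, inner_smul_right, real_inner_comm]
    ring
  add {X X'} hX hX' := by
    have : CompleteSpace E := FiniteDimensional.complete ℝ E
    have h1 : (fun y ↦ inner ℝ ((X + X') y) (Z y))
        = (fun y ↦ inner ℝ (X y) (Z y)) + (fun y ↦ inner ℝ (X' y) (Z y)) := by
      ext y; simp [inner_add_left]
    have h2 : (fun y ↦ inner ℝ ((X + X') y) (Y y))
        = (fun y ↦ inner ℝ (X y) (Y y)) + (fun y ↦ inner ℝ (X' y) (Y y)) := by
      ext y; simp [inner_add_left]
    simp only [koszul, h1, h2]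
    rw [mvfderiv_add (mdifferentiableAt_inner hX hZ) (mdifferentiableAt_inner hX' hZ),
      mvfderiv_add (mdifferentiableAt_inner hX hY) (mdifferentiableAt_inner hX' hY),
      mlieBracket_add_left hX hX', mlieBracket_add_left hX hX']
    simp [inner_add_left, inner_add_right]
    ring

theorem koszul_tensorial_right {x : M} {X Y : Π x : M, TangentSpace I x}
    (hX : MDiffAt (T% X) x) (hY : MDiffAt (T% Y) x) :
    TensorialAt I E (koszul I X Y · x) x where
  smul {f Z} hf hZ := by
    have : CompleteSpace E := FiniteDimensional.complete ℝ E
    have h1 : (fun y ↦ inner ℝ (Y y) ((f • Z) y)) = f * (fun y ↦ inner ℝ (Y y) (Z y)) := by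
      ext y; simp [inner_smul_right]
    have h2 : (fun y ↦ inner ℝ (X y) ((f • Z) y)) = f * (fun y ↦ inner ℝ (X y) (Z y)) := by
      ext y; simp [inner_smul_right]
    simp only [koszul, h1, h2]
    rw [mvfderiv_mul hf (mdifferentiableAt_inner hY hZ),
      mvfderiv_mul hf (mdifferentiableAt_inner hX hZ),
      mlieBracket_smul_right hf hZ, mlieBracket_smul_right hf hZ]
    simp [inner_add_left, inner_smul_left, inner_smul_right, real_inner_comm]
    ring
  add {Z Z'} hZ hZ' := by
    have : CompleteSpace E := FiniteDimensional.complete ℝ E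
    have h1 : (fun y ↦ inner ℝ (Y y) ((Z + Z') y))
        = (fun y ↦ inner ℝ (Y y) (Z y)) + (fun y ↦ inner ℝ (Y y) (Z' y)) := by
      ext y; simp [inner_add_right]
    have h2 : (fun y ↦ inner ℝ (X y) ((Z + Z') y))
        = (fun y ↦ inner ℝ (X y) (Z y)) + (fun y ↦ inner ℝ (X y) (Z' y)) := by
      ext y; simp [inner_add_right]
    simp only [koszul, h1, h2]
    rw [mvfderiv_add (mdifferentiableAt_inner hY hZ) (mdifferentiableAt_inner hY hZ'),
      mvfderiv_add (mdifferentiableAt_inner hX hZ) (mdifferentiableAt_inner hX hZ'),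
      mlieBracket_add_right hZ hZ', mlieBracket_add_right hZ hZ']
    simp [inner_add_left, inner_add_right]
    ring

instance finiteDimensional_tangentSpace (x : M) : FiniteDimensional ℝ (TangentSpace I x) :=
  inferInstanceAs (FiniteDimensional ℝ E)

open scoped Classical in
/-- The endomorphism `v ↦ D_v Y` of `T_x M` determined by `⟨D_X Y, Z⟩ = koszul X Y Z`, for a vector
field `Y` differentiable at `x` (and `0` otherwise). -/
def leviCivitaFun (Y : Π x : M, TangentSpace I x) (x : M) :
    TangentSpace I x →L[ℝ] TangentSpace I x :=
  if hY : MDiffAt (T% Y) x then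
    ∑ i, ((TensorialAt.mkHom₂ (I := I) (F := E) (F' := E) (fun X Z ↦ koszul I X Y Z x) x
      (fun _ hZ ↦ koszul_tensorial_left hY hZ)
      (fun _ hX ↦ koszul_tensorial_right hX hY)).flip
        (stdOrthonormalBasis ℝ (TangentSpace I x) i)).smulRight
          (stdOrthonormalBasis ℝ (TangentSpace I x) i)
  else 0

theorem inner_leviCivitaFun {X Y Z : Π x : M, TangentSpace I x} {x : M}
    (hX : MDiffAt (T% X) x) (hY : MDiffAt (T% Y) x) (hZ : MDiffAt (T% Z) x) :
    inner ℝ (leviCivitaFun Y x (X x)) (Z x) = koszul I X Y Z x := by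
  have key := TensorialAt.mkHom₂_apply (I := I) (F := E) (F' := E)
    (Φ := fun X Z ↦ koszul I X Y Z x)
    (fun _ hZ ↦ koszul_tensorial_left hY hZ) (fun _ hX ↦ koszul_tensorial_right hX hY) hX hZ
  rw [← key, leviCivitaFun, dif_pos hY]
  conv_rhs => rw [← (stdOrthonormalBasis ℝ (TangentSpace I x)).sum_repr' (Z x)]
  simp only [_root_.sum_apply, ContinuousLinearMap.smulRight_apply,
    ContinuousLinearMap.flip_apply, sum_inner, map_sum, map_smul, inner_smul_left, smul_eq_mul]
  exact Finset.sum_congr rfl fun i _ ↦ by simp [mul_comm]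

theorem inner_leviCivitaFun_extend {Y : Π x : M, TangentSpace I x} {x : M}
    (hY : MDiffAt (T% Y) x) (v w : TangentSpace I x) :
    inner ℝ (leviCivitaFun Y x v) w = koszul I (extend E v) Y (extend E w) x := by
  have := inner_leviCivitaFun (mdifferentiableAt_extend I E v) hY (mdifferentiableAt_extend I E w)
  simpa using this

variable (I M) in
/-- The Levi-Civita connection `D` of the Riemannian metric. The value of `D_v Y` is written
`leviCivita I M Y x v`. -/
def leviCivita : CovariantDerivative I E (fun x : M ↦ TangentSpace I x) where
  toFun := leviCivitaFun
  isCovariantDerivativeOnUniv :=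
    { add := by
        intro Y Y' x hY hY' _
        have : CompleteSpace E := FiniteDimensional.complete ℝ E
        ext1 v
        refine ext_inner_right ℝ fun w ↦ ?_
        have hv := mdifferentiableAt_extend I E v
        have hw := mdifferentiableAt_extend I E w
        rw [inner_leviCivitaFun_extend (mdifferentiableAt_add_section hY hY'),
          _root_.add_apply, inner_add_left, inner_leviCivitaFun_extend hY,
          inner_leviCivitaFun_extend hY']
        have h1 (Z : Π x : M, TangentSpace I x) : (fun y ↦ inner ℝ ((Y + Y') y) (Z y))
            = (fun y ↦ inner ℝ (Y y) (Z y)) + (fun y ↦ inner ℝ (Y' y) (Z y)) := by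
          ext y; simp [inner_add_left]
        have h2 (Z : Π x : M, TangentSpace I x) : (fun y ↦ inner ℝ (Z y) ((Y + Y') y))
            = (fun y ↦ inner ℝ (Z y) (Y y)) + (fun y ↦ inner ℝ (Z y) (Y' y)) := by
          ext y; simp [inner_add_right]
        simp only [koszul, h1, h2]
        rw [mvfderiv_add (mdifferentiableAt_inner hY hw) (mdifferentiableAt_inner hY' hw),
          mvfderiv_add (mdifferentiableAt_inner hv hY) (mdifferentiableAt_inner hv hY'),
          mlieBracket_add_right hY hY', mlieBracket_add_left hY hY']
        simp [inner_add_left, inner_add_right]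
        ring
      leibniz := by
        intro Y f x hY hf _
        have : CompleteSpace E := FiniteDimensional.complete ℝ E
        ext1 v
        refine ext_inner_right ℝ fun w ↦ ?_
        have hv := mdifferentiableAt_extend I E v
        have hw := mdifferentiableAt_extend I E w
        rw [inner_leviCivitaFun_extend (hf.smul_section hY),
          _root_.add_apply, inner_add_left, _root_.smul_apply,
          inner_smul_left, inner_leviCivitaFun_extend hY]
        have h1 (Z : Π x : M, TangentSpace I x) : (fun y ↦ inner ℝ ((f • Y) y) (Z y))
            = f * (fun y ↦ inner ℝ (Y y) (Z y)) := by
          ext y; simp [inner_smul_left]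
        have h2 (Z : Π x : M, TangentSpace I x) : (fun y ↦ inner ℝ (Z y) ((f • Y) y))
            = f * (fun y ↦ inner ℝ (Z y) (Y y)) := by
          ext y; simp [inner_smul_right]
        simp only [koszul, h1, h2]
        rw [mvfderiv_mul hf (mdifferentiableAt_inner hY hw),
          mvfderiv_mul hf (mdifferentiableAt_inner hv hY),
          mlieBracket_smul_right hf hY, mlieBracket_smul_left hf hY]
        simp [inner_add_left, inner_smul_left, inner_smul_right, real_inner_comm]
        ring }

/-- The Levi-Civita connection is torsion free. -/
theorem leviCivita_sub_eq_mlieBracket {X Y : Π x : M, TangentSpace I x} {x : M}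
    (hX : MDiffAt (T% X) x) (hY : MDiffAt (T% Y) x) :
    leviCivita I M Y x (X x) - leviCivita I M X x (Y x) = mlieBracket I X Y x := by
  refine ext_inner_right ℝ fun w ↦ ?_
  have hw := mdifferentiableAt_extend I E w
  have h1 := inner_leviCivitaFun hX hY hw
  have h2 := inner_leviCivitaFun hY hX hw
  rw [extend_apply_self] at h1 h2
  rw [inner_sub_left]
  refine (congrArg₂ (· - ·) h1 h2).trans ?_
  simp only [koszul, extend_apply_self]
  rw [mlieBracket_swap_apply (V := Y) (W := X)]
  simp only [real_inner_comm, inner_neg_left]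
  ring

/-- The Levi-Civita connection is compatible with the metric. -/
theorem leviCivita_metric {X Y Z : Π x : M, TangentSpace I x} {x : M}
    (hX : MDiffAt (T% X) x) (hY : MDiffAt (T% Y) x) (hZ : MDiffAt (T% Z) x) :
    mvfderiv I (fun y ↦ inner ℝ (Y y) (Z y)) x (X x) =
      inner ℝ (leviCivita I M Y x (X x)) (Z x) + inner ℝ (Y x) (leviCivita I M Z x (X x)) := by
  have h1 := inner_leviCivitaFun hX hY hZ
  have h2 := inner_leviCivitaFun hX hZ hY
  rw [real_inner_comm (leviCivita I M Z x (X x)) (Y x)]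
  refine Eq.trans ?_ (congrArg₂ (· + ·) h1 h2).symm
  have h3 : (fun y ↦ inner ℝ (Z y) (Y y)) = (fun y ↦ inner ℝ (Y y) (Z y)) := by
    ext y; exact real_inner_comm _ _
  simp only [koszul, h3]
  rw [mlieBracket_swap_apply (V := Z) (W := Y)]
  simp only [inner_neg_left]
  ring

/-- The curvature operator `R(X,Y)Z = D_[X,Y] Z - D_X D_Y Z + D_Y D_X Z`, with the sign convention
in which the sectional curvature of an orthonormal pair `u, v` is `⟨R(u,v)u, v⟩`. -/
def curvatureOp (X Y Z : Π x : M, TangentSpace I x) (x : M) : TangentSpace I x :=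
  leviCivita I M Z x (mlieBracket I X Y x)
    - leviCivita I M (fun y ↦ leviCivita I M Z y (Y y)) x (X x)
    + leviCivita I M (fun y ↦ leviCivita I M Z y (X y)) x (Y x)

/-- The curvature tensor `R(u,v,w,z) = ⟨R(u,v)w, z⟩` at `x`. -/
def riemannTensor (x : M) (u v w z : TangentSpace I x) : ℝ :=
  inner ℝ (curvatureOp (extend E u) (extend E v) (extend E w) x) z

/-- The Ricci tensor `r(u,v) = ∑ i, R(u, eᵢ, v, eᵢ)`, with `(eᵢ)` an orthonormal basis. -/
def ricciTensor (x : M) (u v : TangentSpace I x) : ℝ :=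
  ∑ i, riemannTensor x u (stdOrthonormalBasis ℝ (TangentSpace I x) i) v
    (stdOrthonormalBasis ℝ (TangentSpace I x) i)

variable (I) in
/-- The scalar curvature, the trace of the Ricci tensor. -/
def scalarCurvature (x : M) : ℝ :=
  ∑ i, ricciTensor x (stdOrthonormalBasis ℝ (TangentSpace I x) i)
    (stdOrthonormalBasis ℝ (TangentSpace I x) i)

/-- The Kulkarni-Nomizu product of two bilinear forms. -/
def kulkarniNomizu {V : Type*} (h k : V → V → ℝ) (a b c d : V) : ℝ :=
  h a c * k b d + h b d * k a c - h a d * k b c - h b c * k a d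

/-- The Weyl curvature tensor (in dimension `n ≥ 3`)
`W = R - (1 / (n - 2)) r ∧ g + (s / (2 (n - 1) (n - 2))) g ∧ g`,
where `∧` is the Kulkarni-Nomizu product. -/
def weylTensor (x : M) (a b c d : TangentSpace I x) : ℝ :=
  riemannTensor x a b c d
    - 1 / ((Module.finrank ℝ E : ℝ) - 2)
      * kulkarniNomizu (ricciTensor x) (fun u v ↦ inner ℝ u v) a b c d
    + scalarCurvature I x
        / (2 * ((Module.finrank ℝ E : ℝ) - 1) * ((Module.finrank ℝ E : ℝ) - 2))
      * kulkarniNomizu (fun u v ↦ inner ℝ u v) (fun u v ↦ inner ℝ u v) a b c d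

/-- The covariant derivative `(D_v T)(a,b,c,d)` at `x` of a covariant 4-tensor field `T`. -/
def covDerivTensor (T : Π x : M, TangentSpace I x → TangentSpace I x → TangentSpace I x →
    TangentSpace I x → ℝ) (x : M) (v a b c d : TangentSpace I x) : ℝ :=
  mvfderiv I (fun y ↦ T y (extend E a y) (extend E b y) (extend E c y) (extend E d y)) x v
    - T x (leviCivita I M (extend E a) x v) b c d
    - T x a (leviCivita I M (extend E b) x v) c d
    - T x a b (leviCivita I M (extend E c) x v) d
    - T x a b c (leviCivita I M (extend E d) x v)

/-- The divergence `(δT)(a,b,c) = -∑ i, (D_{eᵢ} T)(eᵢ,a,b,c)`, with `(eᵢ)` an orthonormal basis. -/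
def divTensor (T : Π x : M, TangentSpace I x → TangentSpace I x → TangentSpace I x →
    TangentSpace I x → ℝ) (x : M) (a b c : TangentSpace I x) : ℝ :=
  -∑ i, covDerivTensor T x (stdOrthonormalBasis ℝ (TangentSpace I x) i)
    (stdOrthonormalBasis ℝ (TangentSpace I x) i) a b c

variable (I) in
/-- The gradient of a function: `⟨∇f, v⟩ = df(v)`. -/
def gradientField (f : M → ℝ) (x : M) : TangentSpace I x :=
  have : CompleteSpace (TangentSpace I x) := FiniteDimensional.complete ℝ _
  (InnerProductSpace.toDual ℝ (TangentSpace I x)).symm (mvfderiv I f x)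

/-- The Hessian `Ddf(u,v) = ⟨D_u ∇f, v⟩`. -/
def hessian (f : M → ℝ) (x : M) (u v : TangentSpace I x) : ℝ :=
  inner ℝ (leviCivita I M (gradientField I f) x u) v

variable (I) in
/-- `(M, g, f)` is a gradient Ricci soliton with constant `ρ`: `f` is smooth and
`r + Ddf = ρ g`. -/
def IsGradientRicciSoliton (f : M → ℝ) (ρ : ℝ) : Prop :=
  ContMDiff I 𝓘(ℝ) ∞ f ∧
    ∀ (x : M) (u v : TangentSpace I x),
      ricciTensor x u v + hessian f x u v = ρ * inner ℝ u v

variable (I) in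
/-- The Weyl tensor is weakly harmonic with respect to `f`: `δW(·, ·, ∇f) = 0`. -/
def IsWeaklyHarmonicWeyl (f : M → ℝ) : Prop :=
  ∀ (x : M) (u v : TangentSpace I x), divTensor weylTensor x u v (gradientField I f x) = 0

end RiemannianGeometry

/-! Write `n` for the dimension, `s` for the scalar curvature and `r` for the Ricci tensor. The
contracted second Bianchi identity expresses the divergence of the Weyl tensor as `(n - 3)/(n - 2)`
times the Cotton tensor, up to sign (`sum_nabla₄_weyl`). On a soliton, `r = ρ g - Ddf` with `g`
parallel, so antisymmetrizing `D r` leaves a commutator of second derivatives of `∇f`, which is a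
curvature term: `(D_Y r)(Z,X) - (D_Z r)(Y,X) = R(Y,Z,∇f,X)` (`nabla₂_ric_sub_of_soliton`). For `n ≥
4` the hypothesis `δW(U,V,∇f) = 0` therefore reads `R(V,∇f,∇f,U) = (ds(V)⟨U,∇f⟩ - ds(∇f)⟨U,V⟩) /
(2(n - 1))`. The left side is symmetric in `U, V` by pair symmetry of the curvature, and so is the
last term; hence `ds(V)⟨U,∇f⟩` is symmetric too, that is, `ds ∧ df = 0`. Tracing the commutator
identity against `div r = ds/2` gives `ds = 2 r(∇f, ·)` (`dir_scal_of_soliton`), which fixes the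
proportionality factor where `∇f ≠ 0`.

The definitions are pointwise: they use `extend`, whose output is only known to be smooth near the
base point, and an orthonormal basis chosen separately at each point. The calculus is instead done
with global smooth fields, a module over the ring of smooth functions, where tensor identities
become algebra. Cutoffs, local orthonormal frames and independence of traces from the basis connect
the two descriptions. -/

set_option linter.unusedSectionVars false

/-! ### Global smooth fields, cutoffs and local orthonormal frames. -/

noncomputable section SmoothFields

open Filter Topology InnerProductSpace Module

variable {E : Type*} [NormedAddCommGroup E] [NormedSpace ℝ E]
  {H : Type*} [TopologicalSpace H] {I : ModelWithCorners ℝ E H}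
  {M : Type*} [TopologicalSpace M] [ChartedSpace H M] [IsManifold I ∞ M]

variable (I M) in
/-- The ring of smooth functions on `M`. -/
abbrev SmoothFunction := C^∞⟮I, M; 𝓘(ℝ), ℝ⟯

variable (I M) in
/-- The smooth vector fields on `M`. -/
abbrev SmoothField := Cₛ^∞⟮I; E, (TangentSpace I : M → Type _)⟯

instance : SMul (SmoothFunction I M) (SmoothField I M) :=
  ⟨fun f X ↦ ⟨(f : M → ℝ) • ⇑X, f.contMDiff.smul_section X.contMDiff⟩⟩

@[simp]
theorem SmoothField.smul_apply (f : SmoothFunction I M) (X : SmoothField I M) (x : M) :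
    (f • X) x = f x • X x := rfl

@[simp]
theorem SmoothField.add_apply (X Y : SmoothField I M) (x : M) : (X + Y) x = X x + Y x := rfl

@[simp]
theorem SmoothField.sub_apply (X Y : SmoothField I M) (x : M) : (X - Y) x = X x - Y x := rfl

@[simp]
theorem SmoothField.neg_apply (X : SmoothField I M) (x : M) : (-X) x = -X x := rfl

@[simp]
theorem SmoothField.zero_apply (x : M) : (0 : SmoothField I M) x = 0 := rfl

instance : Module (SmoothFunction I M) (SmoothField I M) where
  one_smul X := by ext x; simp
  mul_smul f g X := by ext x; simp [mul_smul]
  smul_zero f := by ext x; simp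
  smul_add f X Y := by ext x; simp
  add_smul f g X := by ext x; simp [add_smul]
  zero_smul X := by ext x; simp

theorem SmoothField.sum_apply {ι : Type*} (s : Finset ι) (X : ι → SmoothField I M) (x : M) :
    (∑ i ∈ s, X i) x = ∑ i ∈ s, X i x := by
  classical
  induction s using Finset.induction_on with
  | empty => simp
  | insert a s ha h => simp [Finset.sum_insert ha, h]

theorem SmoothFunction.sum_apply {ι : Type*} (s : Finset ι) (f : ι → SmoothFunction I M) (x : M) :
    (∑ i ∈ s, f i) x = ∑ i ∈ s, f i x := by
  classical
  induction s using Finset.induction_on with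
  | empty => simp
  | insert a s ha h => simp [Finset.sum_insert ha, h]

variable [FiniteDimensional ℝ E]

/-- Every neighbourhood of a point supports a smooth function equal to `1` near that point. -/
theorem exists_cutoff [T2Space M] {x : M} {u : Set M} (hu : u ∈ 𝓝 x) :
    ∃ χ : SmoothFunction I M, (∀ᶠ y in 𝓝 x, χ y = 1) ∧ tsupport χ ⊆ u := by
  obtain ⟨ψ, -, hψ⟩ := (SmoothBumpFunction.nhds_basis_tsupport (I := I) x).mem_iff.1 hu
  exact ⟨⟨ψ, ψ.contMDiff⟩, ψ.eventuallyEq_one, hψ⟩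

/-- The product of a section smooth on an open set with a function supported there. -/
def SmoothField.cutoff (χ : SmoothFunction I M) (X : Π x : M, TangentSpace I x) {u : Set M}
    (hu : IsOpen u) (hX : CMDiff[u] ∞ (T% X)) (hχ : tsupport χ ⊆ u) : SmoothField I M :=
  ⟨(χ : M → ℝ) • X, χ.contMDiff.contMDiffOn.smul_section_of_tsupport hu hχ hX⟩

@[simp]
theorem SmoothField.cutoff_apply (χ : SmoothFunction I M) (X : Π x : M, TangentSpace I x)
    {u : Set M} (hu : IsOpen u) (hX : CMDiff[u] ∞ (T% X)) (hχ : tsupport χ ⊆ u) (x : M) :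
    SmoothField.cutoff χ X hu hX hχ x = χ x • X x := rfl

/-- In the trivialization at `x` the extension has constant coordinates, so it is smooth wherever
that trivialization is defined. -/
theorem contMDiffOn_extend_baseSet {x : M} (v : TangentSpace I x) :
    CMDiff[(trivializationAt E (TangentSpace I) x).baseSet] ∞ (T% (extend E v)) := by
  set t := trivializationAt E (TangentSpace I) x with ht
  intro y hy
  refine ContMDiffAt.contMDiffWithinAt ?_
  refine (t.contMDiffAt_section_iff hy).2 ?_
  have : CMDiffAt ∞ (fun _ : M ↦ (t ⟨x, v⟩).2) y := contMDiffAt_const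
  refine this.congr_of_eventuallyEq ?_
  filter_upwards [t.open_baseSet.mem_nhds hy] with z hz
  simp only [extend, ← ht, t.apply_mk_symm hz]

/-- The extension of a tangent vector agrees near the base point with a smooth field. -/
theorem exists_smoothField_eventuallyEq_extend [T2Space M] {x : M} (v : TangentSpace I x) :
    ∃ X : SmoothField I M, ∀ᶠ y in 𝓝 x, X y = extend E v y := by
  set t := trivializationAt E (TangentSpace I) x
  obtain ⟨χ, h1, h2⟩ := exists_cutoff (I := I) (t.open_baseSet.mem_nhds
    (FiberBundle.mem_baseSet_trivializationAt' x))
  refine ⟨SmoothField.cutoff χ _ t.open_baseSet (contMDiffOn_extend_baseSet v) h2, ?_⟩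
  filter_upwards [h1] with y hy
  simp [hy]

variable [RiemannianBundle (fun x : M ↦ TangentSpace I x)]
  [IsContMDiffRiemannianBundle I ∞ E (fun x : M ↦ TangentSpace I x)]

theorem contMDiffOn_inner {u : Set M} {X Y : Π x : M, TangentSpace I x}
    (hX : CMDiff[u] ∞ (T% X)) (hY : CMDiff[u] ∞ (T% Y)) :
    CMDiff[u] ∞ (fun y ↦ (inner ℝ (X y) (Y y) : ℝ)) :=
  ContMDiffOn.inner_bundle (IB := I) (F := E) (E := fun x : M ↦ TangentSpace I x)
    (b := fun y : M ↦ y) hX hY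

/-- Each step subtracts projections onto earlier vectors. Linear independence keeps the denominators
nonzero, so smoothness propagates by induction. -/
theorem contMDiffOn_gramSchmidt {ι : Type*} [LinearOrder ι] [LocallyFiniteOrderBot ι]
    [WellFoundedLT ι] {u : Set M} {s : ι → Π x : M, TangentSpace I x}
    (hs : ∀ i, CMDiff[u] ∞ (T% (s i))) (hli : ∀ x ∈ u, LinearIndependent ℝ (s · x)) (n : ι) :
    CMDiff[u] ∞ (T% (fun x ↦ gramSchmidt ℝ (s · x) n)) := by
  induction n using WellFoundedLT.induction with
  | ind n ih =>
    have h1 : (fun x ↦ gramSchmidt ℝ (s · x) n) = s n - fun x ↦ ∑ i ∈ Finset.Iio n,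
        ((inner ℝ (gramSchmidt ℝ (s · x) i) (s n x) : ℝ) / ‖gramSchmidt ℝ (s · x) i‖ ^ 2) •
          gramSchmidt ℝ (s · x) i := by
      ext x
      rw [gramSchmidt_def]
      simp [Submodule.starProjection_singleton]
    suffices h : CMDiff[u] ∞ (T% (s n - fun x ↦ ∑ i ∈ Finset.Iio n,
        ((inner ℝ (gramSchmidt ℝ (s · x) i) (s n x) : ℝ) / ‖gramSchmidt ℝ (s · x) i‖ ^ 2) •
          gramSchmidt ℝ (s · x) i)) by rwa [← h1] at h
    refine (hs n).sub_section (ContMDiffOn.sum_section fun i hi ↦ ?_)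
    have hi := ih i (Finset.mem_Iio.1 hi)
    refine ContMDiffOn.smul_section ?_ hi
    simp_rw [← real_inner_self_eq_norm_sq]
    refine ContMDiffOn.div₀ (contMDiffOn_inner hi (hs n)) (contMDiffOn_inner hi hi) fun x hx ↦ ?_
    rw [inner_self_ne_zero]
    exact gramSchmidt_ne_zero _ (hli x hx)

theorem contMDiffOn_gramSchmidtNormed {ι : Type*} [LinearOrder ι] [LocallyFiniteOrderBot ι]
    [WellFoundedLT ι] {u : Set M} {s : ι → Π x : M, TangentSpace I x}
    (hs : ∀ i, CMDiff[u] ∞ (T% (s i))) (hli : ∀ x ∈ u, LinearIndependent ℝ (s · x)) (n : ι) :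
    CMDiff[u] ∞ (T% (fun x ↦ gramSchmidtNormed ℝ (s · x) n)) := by
  have h := contMDiffOn_gramSchmidt hs hli n
  have h1 : CMDiff[u] ∞ (fun x ↦ ‖gramSchmidt ℝ (s · x) n‖⁻¹) := by
    intro x hx
    have h0 : gramSchmidt ℝ (s · x) n ≠ 0 := gramSchmidt_ne_zero _ (hli x hx)
    have h2 : ContDiffAt ℝ ∞ (fun r : ℝ ↦ (√r)⁻¹)
        (inner ℝ (gramSchmidt ℝ (s · x) n) (gramSchmidt ℝ (s · x) n)) :=
      (Real.contDiffAt_sqrt (inner_self_ne_zero.2 h0)).inv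
        (Real.sqrt_ne_zero'.2 (real_inner_self_pos.2 h0))
    have h4 : CMDiff[u] ∞ (fun y ↦ (inner ℝ (gramSchmidt ℝ (s · y) n)
        (gramSchmidt ℝ (s · y) n) : ℝ)) := contMDiffOn_inner h h
    have h3 := h2.contMDiffAt.comp_contMDiffWithinAt x (h4 x hx)
    exact h3.congr (fun y _ ↦ by rw [norm_eq_sqrt_real_inner]; rfl)
      (by rw [norm_eq_sqrt_real_inner]; rfl)
  exact h1.smul_section h

/-- A smooth local orthonormal frame, cut off to globally defined fields. -/
theorem exists_orthonormal_frame [T2Space M] (x : M) :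
    ∃ (F : Fin (finrank ℝ E) → SmoothField I M) (χ : SmoothFunction I M),
      (∀ᶠ y in 𝓝 x, Orthonormal ℝ (F · y)) ∧ (∀ᶠ y in 𝓝 x, χ y = 1) ∧
      ∀ (y : M) (v : TangentSpace I y),
        ∑ i, (inner ℝ v (F i y) : ℝ) • F i y = χ y • v := by
  set t := trivializationAt E (TangentSpace I) x with ht
  have hx : x ∈ t.baseSet := FiberBundle.mem_baseSet_trivializationAt' x
  obtain ⟨χ, h1, h2⟩ := exists_cutoff (I := I) (t.open_baseSet.mem_nhds hx)
  let b := finBasis ℝ E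
  have hf := t.isLocalFrameOn_localFrame_baseSet I ∞ b
  have hli (y : M) (hy : y ∈ t.baseSet) : LinearIndependent ℝ (t.localFrame b · y) :=
    hf.linearIndependent hy
  have hsm := contMDiffOn_gramSchmidtNormed hf.contMDiffOn hli
  -- The cut-off frame enters the expansion twice, whence `χ * χ`. Outside the base set both sides
  -- vanish, which makes the expansion an identity on all of `M`.
  refine ⟨fun i ↦ SmoothField.cutoff χ _ t.open_baseSet (hsm i) h2, χ * χ, ?_, ?_, ?_⟩
  · filter_upwards [h1, t.open_baseSet.mem_nhds hx] with y hy hyt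
    simpa [hy] using gramSchmidtNormed_orthonormal (hli y hyt)
  · filter_upwards [h1] with y hy using by simp [hy]
  · intro y v
    by_cases hy : y ∈ t.baseSet
    · have ho := gramSchmidtNormed_orthonormal (hli y hy)
      have hc : Fintype.card (Fin (finrank ℝ E)) = finrank ℝ (TangentSpace I y) := by
        simp; rfl
      let B := OrthonormalBasis.mk ho
        (ho.linearIndependent.span_eq_top_of_card_eq_finrank' hc).ge
      have hB (i) : B i = gramSchmidtNormed ℝ (t.localFrame b · y) i := by simp [B]
      have := B.sum_repr' v
      simp only [hB] at this
      conv_rhs => rw [← this]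
      rw [Finset.smul_sum]
      refine Finset.sum_congr rfl fun i _ ↦ ?_
      simp only [SmoothField.cutoff_apply, inner_smul_right, smul_smul, ContMDiffMap.coe_mul,
        Pi.mul_apply, real_inner_comm]
      congr 1
      ring
    · have : χ y = 0 := image_eq_zero_of_notMem_tsupport fun h ↦ hy (h2 h)
      simp [this]

end SmoothFields

/-! ### Derivations, brackets, the connection and the gradient on smooth fields. -/

noncomputable section SmoothFieldOperations

open Filter Topology InnerProductSpace Module

variable {E : Type*} [NormedAddCommGroup E] [NormedSpace ℝ E]
  {H : Type*} [TopologicalSpace H] {I : ModelWithCorners ℝ E H}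
  {M : Type*} [TopologicalSpace M] [ChartedSpace H M] [IsManifold I ∞ M]

theorem minSmoothness_le_infty (k : ℕ) : minSmoothness ℝ k ≤ ∞ := by
  rw [minSmoothness_of_isRCLikeNormedField]
  exact_mod_cast (le_top : (k : ℕ∞) ≤ ⊤)

local instance : IsManifold I (minSmoothness ℝ 2) M := IsManifold.of_le (minSmoothness_le_infty 2)

local instance : IsManifold I (minSmoothness ℝ 3) M := IsManifold.of_le (minSmoothness_le_infty 3)

/-- The function `X f` is the fibre component of the tangent map of `f` composed with the section
`X`. -/
theorem contMDiff_mvfderiv_apply (X : SmoothField I M) (f : SmoothFunction I M) :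
    CMDiff ∞ (fun x ↦ mvfderiv I f x (X x)) := by
  have h1 := (f.contMDiff.contMDiff_tangentMap (m := ∞) (by simp)).comp X.contMDiff
  have h2 := contMDiff_snd_tangentBundle_modelSpace ℝ 𝓘(ℝ) (n := ∞)
  exact h2.comp h1

namespace SmoothField

/-- The derivative `X f` of a function along a field. -/
def dir (X : SmoothField I M) (f : SmoothFunction I M) : SmoothFunction I M :=
  ⟨fun x ↦ mvfderiv I f x (X x), contMDiff_mvfderiv_apply X f⟩

theorem dir_apply (X : SmoothField I M) (f : SmoothFunction I M) (x : M) :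
    dir X f x = mvfderiv I f x (X x) := rfl

theorem dir_congr (X : SmoothField I M) {f g : SmoothFunction I M} {x : M}
    (h : ∀ᶠ y in 𝓝 x, f y = g y) : dir X f x = dir X g x := by
  have : (f : M → ℝ) =ᶠ[𝓝 x] g := h
  simp only [dir_apply, mvfderiv, this.mfderiv_eq]
  rfl

@[simp]
theorem dir_add_left (X Y : SmoothField I M) (f : SmoothFunction I M) :
    dir (X + Y) f = dir X f + dir Y f := by
  ext x; simp [dir_apply]

@[simp]
theorem dir_smul_left (g : SmoothFunction I M) (X : SmoothField I M) (f : SmoothFunction I M) :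
    dir (g • X) f = g * dir X f := by
  ext x; simp [dir_apply]

@[simp]
theorem dir_add (X : SmoothField I M) (f g : SmoothFunction I M) :
    dir X (f + g) = dir X f + dir X g := by
  ext x
  simp only [dir_apply, ContMDiffMap.coe_add, Pi.add_apply]
  rw [mvfderiv_add f.mdifferentiableAt g.mdifferentiableAt]
  rfl

@[simp]
theorem dir_mul (X : SmoothField I M) (f g : SmoothFunction I M) :
    dir X (f * g) = f * dir X g + g * dir X f := by
  ext x
  simp only [dir_apply, ContMDiffMap.coe_mul, Pi.mul_apply, ContMDiffMap.coe_add, Pi.add_apply]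
  rw [mvfderiv_mul f.mdifferentiableAt g.mdifferentiableAt]
  simp

local instance : IsManifold I (∞ + 1) M := ‹IsManifold I ∞ M›

/-- The Lie bracket of smooth fields. -/
def bracket [CompleteSpace E] (X Y : SmoothField I M) : SmoothField I M :=
  ⟨mlieBracket I X Y, ContDiff.mlieBracket_vectorField (n := ⊤) (m := ⊤) X.contMDiff Y.contMDiff
    (by simp)⟩

theorem bracket_swap [CompleteSpace E] (X Y : SmoothField I M) :
    bracket X Y = -bracket Y X := by
  ext x; exact mlieBracket_swap_apply

theorem bracket_add_right [CompleteSpace E] (X Y Z : SmoothField I M) :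
    bracket X (Y + Z) = bracket X Y + bracket X Z := by
  ext x; exact mlieBracket_add_right Y.mdifferentiableAt Z.mdifferentiableAt

theorem bracket_smul_right [CompleteSpace E] (f : SmoothFunction I M) (X Y : SmoothField I M) :
    bracket X (f • Y) = dir X f • Y + f • bracket X Y := by
  ext x; exact mlieBracket_smul_right f.mdifferentiableAt Y.mdifferentiableAt

theorem bracket_jacobi [CompleteSpace E] (X Y Z : SmoothField I M) :
    bracket X (bracket Y Z) = bracket (bracket X Y) Z + bracket Y (bracket X Z) := by
  ext x
  have h2 : minSmoothness ℝ 2 ≤ ∞ := minSmoothness_le_infty 2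
  exact leibniz_identity_mlieBracket_apply (X.contMDiff.contMDiffAt.of_le h2)
    (Y.contMDiff.contMDiffAt.of_le h2) (Z.contMDiff.contMDiffAt.of_le h2)

/-- Expand the Jacobi identity for `X, Y, f • Z` by the Leibniz rule: the terms with one derivative
of `f` cancel, as does `f` times the Jacobi identity for `X, Y, Z`. What remains is the commutator
formula multiplied by `Z`. -/
theorem dir_bracket_smul [CompleteSpace E] (X Y Z : SmoothField I M) (f : SmoothFunction I M) :
    dir (bracket X Y) f • Z = dir X (dir Y f) • Z - dir Y (dir X f) • Z := by
  have h := bracket_jacobi X Y (f • Z)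
  simp only [bracket_smul_right, bracket_add_right, bracket_jacobi X Y Z, smul_add] at h
  rw [eq_sub_iff_add_eq]
  have h2 := sub_eq_zero.2 h
  rw [← sub_eq_zero, ← neg_eq_zero, ← h2]
  abel

variable [FiniteDimensional ℝ E]

theorem exists_apply_eq [T2Space M] {x : M} (v : TangentSpace I x) :
    ∃ X : SmoothField I M, X x = v := by
  obtain ⟨X, hX⟩ := exists_smoothField_eventuallyEq_extend v
  exact ⟨X, by simpa using hX.self_of_nhds⟩

theorem dir_bracket [T2Space M] [CompleteSpace E] (X Y : SmoothField I M)
    (f : SmoothFunction I M) :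
    dir (bracket X Y) f = dir X (dir Y f) - dir Y (dir X f) := by
  ext x
  -- A field `Z` with `Z x ≠ 0` can be cancelled; if the tangent space is zero, every derivative at
  -- `x` vanishes.
  by_cases h : ∃ v : TangentSpace I x, v ≠ 0
  · obtain ⟨v, hv⟩ := h
    obtain ⟨Z, rfl⟩ := exists_apply_eq v
    have := congrArg (fun W : SmoothField I M ↦ W x) (dir_bracket_smul X Y Z f)
    simp only [smul_apply, ← sub_smul] at this
    exact smul_left_injective ℝ hv this
  · push Not at h
    simp [dir_apply, h]

variable [RiemannianBundle (fun x : M ↦ TangentSpace I x)]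
  [IsContMDiffRiemannianBundle I ∞ E (fun x : M ↦ TangentSpace I x)]

/-- The function `⟨X, Y⟩`. -/
def ip (X Y : SmoothField I M) : SmoothFunction I M :=
  ⟨fun x ↦ inner ℝ (X x) (Y x), contMDiffOn_univ.1
    (contMDiffOn_inner X.contMDiff.contMDiffOn Y.contMDiff.contMDiffOn)⟩

theorem ip_apply (X Y : SmoothField I M) (x : M) : ip X Y x = inner ℝ (X x) (Y x) := rfl

theorem ip_comm (X Y : SmoothField I M) : ip X Y = ip Y X := by
  ext x; exact real_inner_comm (Y x) (X x)

@[simp]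
theorem ip_add_left (X Y Z : SmoothField I M) : ip (X + Y) Z = ip X Z + ip Y Z := by
  ext x; simp [ip_apply, inner_add_left]

@[simp]
theorem ip_add_right (X Y Z : SmoothField I M) : ip X (Y + Z) = ip X Y + ip X Z := by
  ext x; simp [ip_apply, inner_add_right]

@[simp]
theorem ip_sub_left (X Y Z : SmoothField I M) : ip (X - Y) Z = ip X Z - ip Y Z := by
  ext x; simp [ip_apply, inner_sub_left]

@[simp]
theorem ip_neg_left (X Y : SmoothField I M) : ip (-X) Y = -ip X Y := by
  ext x; simp [ip_apply]

@[simp]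
theorem ip_smul_left (f : SmoothFunction I M) (X Y : SmoothField I M) :
    ip (f • X) Y = f * ip X Y := by
  ext x; simp [ip_apply, inner_smul_left]

@[simp]
theorem ip_smul_right (f : SmoothFunction I M) (X Y : SmoothField I M) :
    ip X (f • Y) = f * ip X Y := by
  ext x; simp [ip_apply, inner_smul_right]

/-- A section is smooth if its inner products with smooth fields are. -/
theorem contMDiff_of_inner [T2Space M] {X : Π x : M, TangentSpace I x}
    (h : ∀ Y : SmoothField I M, CMDiff ∞ (fun y ↦ (inner ℝ (X y) (Y y) : ℝ))) :
    CMDiff ∞ (T% X) := by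
  intro x
  obtain ⟨F, χ, -, h1, h2⟩ := exists_orthonormal_frame (I := I) x
  have h3 : CMDiff ∞ (T% (fun y ↦ ∑ i, (inner ℝ (X y) (F i y) : ℝ) • F i y)) :=
    ContMDiff.sum_section fun i _ ↦ (h (F i)).smul_section (F i).contMDiff
  refine (h3 x).congr_of_eventuallyEq ?_
  filter_upwards [h1] with y hy
  simp [h2, hy]

variable [T2Space M]

/-- Against a smooth field `Z` the inner product is the Koszul expression, built from smooth
functions, and pairings with smooth fields detect smoothness. -/
theorem contMDiff_leviCivita (X Y : SmoothField I M) :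
    CMDiff ∞ (T% (fun x ↦ leviCivita I M Y x (X x))) := by
  have : CompleteSpace E := FiniteDimensional.complete ℝ E
  refine contMDiff_of_inner fun Z ↦ ?_
  let K : SmoothFunction I M := (1 / 2 : ℝ) • (dir X (ip Y Z) + dir Y (ip X Z) - dir Z (ip X Y)
    + ip (bracket X Y) Z - ip (bracket X Z) Y - ip (bracket Y Z) X)
  refine K.contMDiff.congr fun x ↦ ?_
  exact inner_leviCivitaFun X.mdifferentiableAt Y.mdifferentiableAt Z.mdifferentiableAt

/-- The covariant derivative `D_X Y` of smooth fields. -/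
def nabla (X Y : SmoothField I M) : SmoothField I M :=
  ⟨fun x ↦ leviCivita I M Y x (X x), contMDiff_leviCivita X Y⟩

theorem nabla_apply (X Y : SmoothField I M) (x : M) :
    nabla X Y x = leviCivita I M Y x (X x) := rfl

@[simp]
theorem nabla_add_left (X Y Z : SmoothField I M) :
    nabla (X + Y) Z = nabla X Z + nabla Y Z := by
  ext x; simp [nabla_apply]

@[simp]
theorem nabla_sub_left (X Y Z : SmoothField I M) :
    nabla (X - Y) Z = nabla X Z - nabla Y Z := by
  ext x; simp [nabla_apply]

@[simp]
theorem nabla_neg_left (X Z : SmoothField I M) : nabla (-X) Z = -nabla X Z := by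
  ext x; simp [nabla_apply]

@[simp]
theorem nabla_smul_left (f : SmoothFunction I M) (X Z : SmoothField I M) :
    nabla (f • X) Z = f • nabla X Z := by
  ext x; simp [nabla_apply]

@[simp]
theorem nabla_add_right (X Y Z : SmoothField I M) :
    nabla X (Y + Z) = nabla X Y + nabla X Z := by
  ext x
  exact congrArg (fun A ↦ A (X x)) ((leviCivita I M).isCovariantDerivativeOn.add (s := Set.univ)
    Y.mdifferentiableAt Z.mdifferentiableAt)

@[simp]
theorem nabla_smul_right (f : SmoothFunction I M) (X Y : SmoothField I M) :
    nabla X (f • Y) = f • nabla X Y + dir X f • Y := by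
  ext x
  exact congrArg (fun A ↦ A (X x)) ((leviCivita I M).isCovariantDerivativeOn.leibniz
    (s := Set.univ) Y.mdifferentiableAt f.mdifferentiableAt)

/-- The additive map `Y ↦ D_X Y`. -/
def nablaHom (X : SmoothField I M) : SmoothField I M →+ SmoothField I M :=
  AddMonoidHom.mk' (nabla X) (nabla_add_right X)

@[simp]
theorem nabla_sub_right (X Y Z : SmoothField I M) :
    nabla X (Y - Z) = nabla X Y - nabla X Z := map_sub (nablaHom X) Y Z

theorem nabla_sub_nabla_swap [CompleteSpace E] (X Y : SmoothField I M) :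
    nabla X Y - nabla Y X = bracket X Y := by
  ext x
  exact leviCivita_sub_eq_mlieBracket X.mdifferentiableAt Y.mdifferentiableAt

theorem dir_ip (X Y Z : SmoothField I M) :
    dir X (ip Y Z) = ip (nabla X Y) Z + ip Y (nabla X Z) := by
  ext x
  exact leviCivita_metric X.mdifferentiableAt Y.mdifferentiableAt Z.mdifferentiableAt

theorem inner_gradientField (f : M → ℝ) (x : M) (v : TangentSpace I x) :
    inner ℝ (gradientField I f x) v = mvfderiv I f x v := by
  have : CompleteSpace (TangentSpace I x) := FiniteDimensional.complete ℝ _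
  exact InnerProductSpace.toDual_symm_apply

/-- The gradient of a smooth function. -/
def grad (f : SmoothFunction I M) : SmoothField I M :=
  ⟨gradientField I f, contMDiff_of_inner fun Y ↦
    (dir Y f).contMDiff.congr fun x ↦ inner_gradientField f x (Y x)⟩

theorem grad_apply (f : SmoothFunction I M) (x : M) : grad f x = gradientField I f x := rfl

end SmoothField

end SmoothFieldOperations

/-! ### Symmetries of the curvature and the Bianchi identities. -/

noncomputable section CurvatureIdentities

open Filter Topology InnerProductSpace Module

variable {E : Type*} [NormedAddCommGroup E] [NormedSpace ℝ E]
  {H : Type*} [TopologicalSpace H] {I : ModelWithCorners ℝ E H}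
  {M : Type*} [TopologicalSpace M] [ChartedSpace H M] [IsManifold I ∞ M]
  [FiniteDimensional ℝ E] [CompleteSpace E] [T2Space M]
  [RiemannianBundle (fun x : M ↦ TangentSpace I x)]
  [IsContMDiffRiemannianBundle I ∞ E (fun x : M ↦ TangentSpace I x)]

namespace SmoothField

theorem bracket_add_left (X Y Z : SmoothField I M) :
    bracket (X + Y) Z = bracket X Z + bracket Y Z := by
  rw [bracket_swap, bracket_add_right, bracket_swap Z X, bracket_swap Z Y]
  abel

theorem bracket_smul_left (f : SmoothFunction I M) (X Y : SmoothField I M) :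
    bracket (f • X) Y = f • bracket X Y - dir Y f • X := by
  rw [bracket_swap, bracket_smul_right, bracket_swap Y X, smul_neg]
  abel

theorem bracket_neg_right (X Y : SmoothField I M) : bracket X (-Y) = -bracket X Y :=
  map_neg (AddMonoidHom.mk' (bracket X) (bracket_add_right X)) Y

theorem bracket_cyclic (X Y Z : SmoothField I M) :
    bracket X (bracket Y Z) + bracket Y (bracket Z X) + bracket Z (bracket X Y) = 0 := by
  rw [bracket_jacobi X Y Z, bracket_swap (bracket X Y) Z, bracket_swap X Z, bracket_neg_right]
  abel

/-- The curvature operator `R(X,Y)Z = D_[X,Y] Z - D_X D_Y Z + D_Y D_X Z` of smooth fields. -/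
def curv (X Y Z : SmoothField I M) : SmoothField I M :=
  nabla (bracket X Y) Z - nabla X (nabla Y Z) + nabla Y (nabla X Z)

theorem curv_swap (X Y Z : SmoothField I M) : curv X Y Z = -curv Y X Z := by
  rw [curv, curv, bracket_swap X Y, nabla_neg_left]
  abel

theorem curv_add_left (X X' Y Z : SmoothField I M) :
    curv (X + X') Y Z = curv X Y Z + curv X' Y Z := by
  simp only [curv, bracket_add_left, nabla_add_left, nabla_add_right]
  abel

theorem curv_smul_left (f : SmoothFunction I M) (X Y Z : SmoothField I M) :
    curv (f • X) Y Z = f • curv X Y Z := by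
  simp only [curv, bracket_smul_left, nabla_sub_left, nabla_smul_left, nabla_smul_right]
  module

theorem curv_add_middle (X Y Y' Z : SmoothField I M) :
    curv X (Y + Y') Z = curv X Y Z + curv X Y' Z := by
  rw [curv_swap, curv_add_left, curv_swap X Y, curv_swap X Y']
  abel

theorem curv_smul_middle (f : SmoothFunction I M) (X Y Z : SmoothField I M) :
    curv X (f • Y) Z = f • curv X Y Z := by
  rw [curv_swap, curv_smul_left, curv_swap X Y, smul_neg]

theorem curv_add_right (X Y Z Z' : SmoothField I M) :
    curv X Y (Z + Z') = curv X Y Z + curv X Y Z' := by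
  simp only [curv, nabla_add_right]
  abel

/-- The terms with one derivative of `f` cancel in pairs; the second-order ones cancel because
`[X,Y] f = X Y f - Y X f`. -/
theorem curv_smul_right (f : SmoothFunction I M) (X Y Z : SmoothField I M) :
    curv X Y (f • Z) = f • curv X Y Z := by
  simp only [curv, nabla_smul_right, nabla_add_right, dir_bracket]
  module

/-- The first Bianchi identity. -/
theorem curv_cyclic (X Y Z : SmoothField I M) :
    curv X Y Z + curv Y Z X + curv Z X Y = 0 := by
  -- Torsion-freeness, used once on inner derivatives and once on outer ones, turns the cyclic sum
  -- into minus the Jacobi sum.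
  have h (X Y Z : SmoothField I M) :
      nabla X (nabla Y Z) - nabla X (nabla Z Y) = nabla X (bracket Y Z) := by
    rw [← nabla_sub_right, nabla_sub_nabla_swap]
  have h1 := nabla_sub_nabla_swap X (bracket Y Z)
  have h2 := nabla_sub_nabla_swap Y (bracket Z X)
  have h3 := nabla_sub_nabla_swap Z (bracket X Y)
  rw [← h] at h1 h2 h3
  rw [← neg_eq_zero, ← bracket_cyclic X Y Z, ← h1, ← h2, ← h3]
  simp only [curv]
  abel

/-- The covariant derivative of the curvature operator. -/
def nablaCurv (V X Y Z : SmoothField I M) : SmoothField I M :=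
  nabla V (curv X Y Z) - curv (nabla V X) Y Z - curv X (nabla V Y) Z - curv X Y (nabla V Z)

/-- The second Bianchi identity. -/
theorem nablaCurv_cyclic (X Y Z W : SmoothField I M) :
    nablaCurv X Y Z W + nablaCurv Y Z X W + nablaCurv Z X Y W = 0 := by
  -- Trading `D_X Y` for `D_Y X + [X,Y]` cancels the terms with a differentiated first or second
  -- slot, up to terms `R([X,Y],Z)W`. Their third-order parts cancel against the rest and leave the
  -- derivative of `W` along the Jacobi sum.
  have a (X Y Z : SmoothField I M) :
      curv (nabla X Y) Z W = curv (nabla Y X) Z W + curv (bracket X Y) Z W := by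
    rw [← curv_add_left, ← nabla_sub_nabla_swap]
    congr 1
    abel
  have b : nabla (bracket X (bracket Y Z)) W + nabla (bracket Y (bracket Z X)) W
      + nabla (bracket Z (bracket X Y)) W = 0 := by
    rw [← nabla_add_left, ← nabla_add_left, bracket_cyclic]
    ext x
    simp [nabla_apply]
  simp only [nablaCurv]
  rw [curv_swap Y (nabla X Z), curv_swap Z (nabla Y X), curv_swap X (nabla Z Y), a X Y Z, a Y Z X,
    a Z X Y]
  refine Eq.trans ?_ b
  simp only [curv, nabla_sub_right, nabla_add_right]
  rw [bracket_swap (bracket X Y) Z, bracket_swap (bracket Y Z) X, bracket_swap (bracket Z X) Y]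
  simp only [nabla_neg_left]
  abel

/-- The curvature tensor `R(X,Y,Z,W) = ⟨R(X,Y)Z, W⟩` of smooth fields. -/
def riem (X Y Z W : SmoothField I M) : SmoothFunction I M := ip (curv X Y Z) W

theorem riem_swap_left (X Y Z W : SmoothField I M) : riem X Y Z W = -riem Y X Z W := by
  rw [riem, curv_swap, ip_neg_left, riem]

/-- Metric compatibility: apply `[X,Y] = XY - YX` to `⟨Z,W⟩`; the mixed first-derivative terms
cancel. -/
theorem riem_swap_right (X Y Z W : SmoothField I M) : riem X Y Z W = -riem X Y W Z := by
  have h := dir_bracket X Y (ip Z W)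
  simp only [dir_ip, dir_add] at h
  simp only [riem, curv, ip_add_left, ip_sub_left]
  rw [ip_comm Z (nabla X (nabla Y W)), ip_comm Z (nabla Y (nabla X W)),
    ip_comm Z (nabla (bracket X Y) W)] at h
  linear_combination h

theorem riem_cyclic (X Y Z W : SmoothField I M) :
    riem X Y Z W + riem Y Z X W + riem Z X Y W = 0 := by
  simp only [riem]
  rw [← ip_add_left, ← ip_add_left, curv_cyclic]
  ext x
  simp [ip_apply]

/-- The classical octahedron argument: a linear combination of four first Bianchi identities and the
two skew symmetries. -/
theorem riem_pair (X Y Z W : SmoothField I M) : riem X Y Z W = riem Z W X Y := by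
  ext x
  have c (X Y Z W : SmoothField I M) :
      riem X Y Z W x + riem Y Z X W x + riem Z X Y W x = 0 :=
    congrArg (fun f : SmoothFunction I M ↦ f x) (riem_cyclic X Y Z W)
  have l (X Y Z W : SmoothField I M) : riem X Y Z W x = -riem Y X Z W x :=
    congrArg (fun f : SmoothFunction I M ↦ f x) (riem_swap_left X Y Z W)
  have r (X Y Z W : SmoothField I M) : riem X Y Z W x = -riem X Y W Z x :=
    congrArg (fun f : SmoothFunction I M ↦ f x) (riem_swap_right X Y Z W)
  linarith [c X Y Z W, c Y Z W X, c Z W X Y, c W X Y Z, l X Y Z W, l Y Z X W, l Z X Y W,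
    l Z W X Y, l W X Y Z, l Y Z W X, l X Z W Y, l Y W X Z, r X Y Z W, r Y Z X W, r Z X Y W,
    r Z W X Y, r W X Y Z, r Y Z W X, r X Z W Y, r Y W X Z, r W Y Z X, r X Z Y W, r W X Z Y,
    l W Y Z X, l Z W Y X, l W X Z Y]

end SmoothField

end CurvatureIdentities

/-! ### Tensoriality, and traces in orthonormal frames. -/

noncomputable section TensorTraces

open Filter Topology InnerProductSpace Module

variable {E : Type*} [NormedAddCommGroup E] [NormedSpace ℝ E]
  {H : Type*} [TopologicalSpace H] {I : ModelWithCorners ℝ E H}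
  {M : Type*} [TopologicalSpace M] [ChartedSpace H M] [IsManifold I ∞ M]

namespace SmoothField

/-- An operation on smooth fields which is linear over smooth functions. -/
structure IsTensor₁ (Φ : SmoothField I M → SmoothFunction I M) : Prop where
  add X Y : Φ (X + Y) = Φ X + Φ Y
  smul f X : Φ (f • X) = f * Φ X

/-- An operation on pairs of smooth fields which is bilinear over smooth functions. -/
structure IsTensor₂ (B : SmoothField I M → SmoothField I M → SmoothFunction I M) : Prop where
  left Y : IsTensor₁ (B · Y)
  right X : IsTensor₁ (B X)

variable [FiniteDimensional ℝ E] [T2Space M]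
  [RiemannianBundle (fun x : M ↦ TangentSpace I x)]
  [IsContMDiffRiemannianBundle I ∞ E (fun x : M ↦ TangentSpace I x)]

theorem IsTensor₁.sum {Φ : SmoothField I M → SmoothFunction I M} (h : IsTensor₁ Φ)
    {ι : Type*} (s : Finset ι) (X : ι → SmoothField I M) :
    Φ (∑ i ∈ s, X i) = ∑ i ∈ s, Φ (X i) :=
  map_sum (AddMonoidHom.mk' Φ h.add) X s

/-- The value of a tensor at a point depends only on the value of the field at that point. -/
theorem IsTensor₁.apply_eq {Φ : SmoothField I M → SmoothFunction I M} (h : IsTensor₁ Φ) {x : M}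
    {X Y : SmoothField I M} (hXY : X x = Y x) : Φ X x = Φ Y x := by
  obtain ⟨F, χ, -, h1, h2⟩ := exists_orthonormal_frame (I := I) x
  have key (X : SmoothField I M) : Φ X x = ∑ i, inner ℝ (X x) (F i x) * Φ (F i) x := by
    -- `Φ` acts on global fields only, so the expansion must hold everywhere; at `x` the factor `χ`
    -- is `1`.
    have e : χ • X = ∑ i, ip X (F i) • F i := by
      ext y
      rw [sum_apply]
      exact (h2 y (X y)).symm
    have := congrArg (fun f : SmoothFunction I M ↦ f x) (congrArg Φ e)
    simp only [h.smul, h.sum, SmoothFunction.sum_apply, ContMDiffMap.coe_mul, Pi.mul_apply,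
      h1.self_of_nhds, one_mul] at this
    exact this
  rw [key, key, hXY]

theorem IsTensor₂.apply_eq {B : SmoothField I M → SmoothField I M → SmoothFunction I M}
    (h : IsTensor₂ B) {x : M} {X X' Y Y' : SmoothField I M} (hX : X x = X' x) (hY : Y x = Y' x) :
    B X Y x = B X' Y' x :=
  ((h.left Y).apply_eq hX).trans ((h.right X').apply_eq hY)

variable {ι κ : Type*} [Fintype ι] [Fintype κ]

/-- The values of a family of fields at a point form an orthonormal basis. -/
structure IsOrthonormalAt (A : ι → SmoothField I M) (x : M) : Prop where
  orthonormal : Orthonormal ℝ (A · x)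
  sum_smul (v : TangentSpace I x) : ∑ i, (inner ℝ v (A i x) : ℝ) • A i x = v

theorem IsOrthonormalAt.of_basis {x : M} (b : OrthonormalBasis ι ℝ (TangentSpace I x))
    {A : ι → SmoothField I M} (hA : ∀ i, A i x = b i) : IsOrthonormalAt A x where
  orthonormal := by simpa only [hA] using b.orthonormal
  sum_smul v := by
    simp only [hA]
    conv_rhs => rw [← b.sum_repr' v]
    simp only [real_inner_comm]

/-- The expansion of a tensor along fields which are orthonormal at a point. -/
theorem IsOrthonormalAt.sum_mul {A : ι → SmoothField I M} {x : M} (hA : IsOrthonormalAt A x)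
    {Φ : SmoothField I M → SmoothFunction I M} (h : IsTensor₁ Φ) (X : SmoothField I M) :
    ∑ i, inner ℝ (X x) (A i x) * Φ (A i) x = Φ X x := by
  have e : X x = (∑ i, ip X (A i) • A i) x := by
    rw [sum_apply]
    exact (hA.sum_smul (X x)).symm
  rw [h.apply_eq e, h.sum]
  simp only [h.smul, SmoothFunction.sum_apply, ContMDiffMap.coe_mul, Pi.mul_apply]
  rfl

/-- The trace of a bilinear tensor does not depend on the orthonormal basis. -/
theorem IsOrthonormalAt.trace_eq {A : ι → SmoothField I M} {F : κ → SmoothField I M} {x : M}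
    (hA : IsOrthonormalAt A x) (hF : IsOrthonormalAt F x)
    {B : SmoothField I M → SmoothField I M → SmoothFunction I M} (h : IsTensor₂ B) :
    ∑ i, B (A i) (A i) x = ∑ k, B (F k) (F k) x := by
  have h1 (i : ι) : B (A i) (A i) x = ∑ k, inner ℝ (A i x) (F k x) * B (F k) (A i) x :=
    (hF.sum_mul (h.left (A i)) (A i)).symm
  simp only [h1]
  rw [Finset.sum_comm]
  refine Finset.sum_congr rfl fun k _ ↦ ?_
  rw [← hA.sum_mul (h.right (F k)) (F k)]
  simp only [real_inner_comm]

/-- An orthonormal frame near a point, consisting of globally defined smooth fields. -/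
theorem exists_eventually_isOrthonormalAt (x : M) :
    ∃ F : Fin (finrank ℝ E) → SmoothField I M, ∀ᶠ y in 𝓝 x, IsOrthonormalAt F y := by
  obtain ⟨F, χ, h1, h2, h3⟩ := exists_orthonormal_frame (I := I) x
  refine ⟨F, ?_⟩
  filter_upwards [h1, h2] with y hy1 hy2
  exact ⟨hy1, fun v ↦ by rw [h3, hy2, one_smul]⟩

variable [CompleteSpace E]

/-- The covariant derivative of a bilinear tensor. -/
def nabla₂ (B : SmoothField I M → SmoothField I M → SmoothFunction I M)
    (V X Y : SmoothField I M) : SmoothFunction I M :=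
  dir V (B X Y) - B (nabla V X) Y - B X (nabla V Y)

theorem IsTensor₂.nabla₂ {B : SmoothField I M → SmoothField I M → SmoothFunction I M}
    (h : IsTensor₂ B) (V : SmoothField I M) : IsTensor₂ (nabla₂ B V) where
  left Y :=
    { add X X' := by
        simp only [SmoothField.nabla₂, nabla_add_right, (h.left _).add, dir_add]
        ring
      smul f X := by
        simp only [SmoothField.nabla₂, nabla_smul_right, (h.left _).add, (h.left _).smul, dir_mul]
        ring }
  right X :=
    { add Y Y' := by
        simp only [SmoothField.nabla₂, nabla_add_right, (h.right _).add, dir_add]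
        ring
      smul f Y := by
        simp only [SmoothField.nabla₂, nabla_smul_right, (h.right _).add, (h.right _).smul, dir_mul]
        ring }

/-- The trace of a bilinear tensor commutes with covariant differentiation. -/
theorem IsOrthonormalAt.dir_trace {A : ι → SmoothField I M} {x : M} (hA : IsOrthonormalAt A x)
    {B : SmoothField I M → SmoothField I M → SmoothFunction I M} (h : IsTensor₂ B)
    {τ : SmoothFunction I M}
    (hτ : ∀ (y : M) (F : Fin (finrank ℝ E) → SmoothField I M), IsOrthonormalAt F y →
      τ y = ∑ i, B (F i) (F i) y)
    (V : SmoothField I M) :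
    dir V τ x = ∑ i, nabla₂ B V (A i) (A i) x := by
  obtain ⟨F, hF⟩ := exists_eventually_isOrthonormalAt (I := I) x
  have hFx := hF.self_of_nhds
  -- `A` is orthonormal only at `x`, whereas differentiating needs a frame orthonormal nearby; the
  -- trace is the same in both.
  rw [hA.trace_eq hFx (h.nabla₂ V)]
  have h1 : ∀ᶠ y in 𝓝 x, τ y = (∑ i, B (F i) (F i)) y := by
    filter_upwards [hF] with y hy
    rw [hτ y F hy, SmoothFunction.sum_apply]
  rw [dir_congr V h1]
  have h2 : dir V (∑ i, B (F i) (F i)) = ∑ i, dir V (B (F i) (F i)) :=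
    map_sum (AddMonoidHom.mk' (dir V) (dir_add V)) _ _
  -- The connection coefficients of an orthonormal frame are skew: differentiate `⟨F i, F j⟩ = δᵢⱼ`.
  -- Hence the frame-derivative terms of the trace cancel in `h8`.
  have hω (i j) : (inner ℝ (nabla V (F i) x) (F j x) : ℝ) = -inner ℝ (nabla V (F j) x) (F i x) := by
    have h3 : ∀ᶠ y in 𝓝 x, ip (F i) (F j) y =
        (if i = j then 1 else 0 : SmoothFunction I M) y := by
      filter_upwards [hF] with y hy
      rw [ip_apply, orthonormal_iff_ite.1 hy.orthonormal]
      split_ifs <;> simp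
    have h4 := dir_congr V h3
    have h5 : dir V (if i = j then 1 else 0 : SmoothFunction I M) = 0 := by
      have h6 : dir V (1 : SmoothFunction I M) = 0 := by simpa using dir_mul V 1 1
      have h7 : dir V (0 : SmoothFunction I M) = 0 := by simpa using dir_add V 0 0
      split_ifs <;> assumption
    rw [h5, dir_ip] at h4
    simp only [ContMDiffMap.coe_add, Pi.add_apply, ip_apply, ContMDiffMap.coe_zero,
      Pi.zero_apply] at h4
    rw [real_inner_comm (nabla V (F j) x)] at h4
    linarith
  have h8 : ∑ i, (B (nabla V (F i)) (F i) x + B (F i) (nabla V (F i)) x) = 0 := by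
    have e1 (i) : B (nabla V (F i)) (F i) x =
        ∑ j, inner ℝ (nabla V (F i) x) (F j x) * B (F j) (F i) x :=
      (hFx.sum_mul (h.left (F i)) _).symm
    have e2 (i) : B (F i) (nabla V (F i)) x =
        ∑ j, inner ℝ (nabla V (F i) x) (F j x) * B (F i) (F j) x :=
      (hFx.sum_mul (h.right (F i)) _).symm
    simp only [e1, e2, Finset.sum_add_distrib]
    rw [Finset.sum_comm, ← Finset.sum_add_distrib]
    refine Finset.sum_eq_zero fun i _ ↦ ?_
    rw [← Finset.sum_add_distrib]
    refine Finset.sum_eq_zero fun j _ ↦ ?_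
    rw [hω j i]
    ring
  rw [h2, SmoothFunction.sum_apply, ← sub_eq_zero, ← Finset.sum_sub_distrib, ← h8]
  refine Finset.sum_congr rfl fun i _ ↦ ?_
  simp only [SmoothField.nabla₂, ContMDiffMap.coe_sub, Pi.sub_apply]
  ring

end SmoothField

end TensorTraces

/-! ### Pointwise curvature tensors as operations on smooth fields. -/

noncomputable section CurvatureTensors

open Filter Topology InnerProductSpace Module

variable {E : Type*} [NormedAddCommGroup E] [NormedSpace ℝ E]
  {H : Type*} [TopologicalSpace H] {I : ModelWithCorners ℝ E H}
  {M : Type*} [TopologicalSpace M] [ChartedSpace H M] [IsManifold I ∞ M]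
  [FiniteDimensional ℝ E] [CompleteSpace E] [T2Space M]
  [RiemannianBundle (fun x : M ↦ TangentSpace I x)]
  [IsContMDiffRiemannianBundle I ∞ E (fun x : M ↦ TangentSpace I x)]

namespace SmoothField

theorem mdifferentiableAt_of_eventuallyEq (X : SmoothField I M) {Y : Π x : M, TangentSpace I x}
    {x : M} (h : ∀ᶠ y in 𝓝 x, X y = Y y) : MDiffAt (T% Y) x :=
  X.mdifferentiableAt.congr_of_eventuallyEq (h.mono fun y hy ↦ by simp [hy])

theorem leviCivita_congr (X : SmoothField I M) {Y : Π x : M, TangentSpace I x} {x : M}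
    (h : ∀ᶠ y in 𝓝 x, X y = Y y) : leviCivita I M Y x = leviCivita I M X x :=
  (leviCivita I M).isCovariantDerivativeOn.congr_of_eventuallyEq (s := Set.univ)
    (X.mdifferentiableAt_of_eventuallyEq h) X.mdifferentiableAt univ_mem
    (h.mono fun _ hy ↦ hy.symm)

theorem eventually_nabla_eq {X Y : SmoothField I M} {X' Y' : Π x : M, TangentSpace I x} {x : M}
    (hX : ∀ᶠ y in 𝓝 x, X y = X' y) (hY : ∀ᶠ y in 𝓝 x, Y y = Y' y) :
    ∀ᶠ y in 𝓝 x, nabla X Y y = leviCivita I M Y' y (X' y) := by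
  filter_upwards [hX, hY.eventually_nhds] with y hyX hyY
  rw [nabla_apply, leviCivita_congr Y hyY, hyX]

/-- Two derivatives are taken, so agreement of germs at `x` is needed; the inner derivatives then
agree near `x` as well. -/
theorem curvatureOp_eq {X Y Z : SmoothField I M} {X' Y' Z' : Π x : M, TangentSpace I x} {x : M}
    (hX : ∀ᶠ y in 𝓝 x, X y = X' y) (hY : ∀ᶠ y in 𝓝 x, Y y = Y' y)
    (hZ : ∀ᶠ y in 𝓝 x, Z y = Z' y) :
    curvatureOp X' Y' Z' x = curv X Y Z x := by
  have hb : mlieBracket I X' Y' x = bracket X Y x :=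
    EventuallyEq.mlieBracket_vectorField_eq (hX.mono fun _ h ↦ h.symm) (hY.mono fun _ h ↦ h.symm)
  rw [curvatureOp, leviCivita_congr Z hZ, leviCivita_congr _ (eventually_nabla_eq hY hZ),
    leviCivita_congr _ (eventually_nabla_eq hX hZ), hb, ← hX.self_of_nhds, ← hY.self_of_nhds]
  rfl

theorem isTensor₁_riem₁ (Y Z W : SmoothField I M) : IsTensor₁ (fun X ↦ riem X Y Z W) where
  add X X' := by simp [riem, curv_add_left]
  smul f X := by simp [riem, curv_smul_left]

theorem isTensor₁_riem₂ (X Z W : SmoothField I M) : IsTensor₁ (fun Y ↦ riem X Y Z W) where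
  add Y Y' := by simp [riem, curv_add_middle]
  smul f Y := by simp [riem, curv_smul_middle]

theorem isTensor₁_riem₃ (X Y W : SmoothField I M) : IsTensor₁ (fun Z ↦ riem X Y Z W) where
  add Z Z' := by simp [riem, curv_add_right]
  smul f Z := by simp [riem, curv_smul_right]

theorem isTensor₁_riem₄ (X Y Z : SmoothField I M) : IsTensor₁ (fun W ↦ riem X Y Z W) where
  add W W' := by simp [riem]
  smul f W := by simp [riem]

theorem isTensor₂_riem (X Z : SmoothField I M) : IsTensor₂ (fun Y W ↦ riem X Y Z W) where
  left W := isTensor₁_riem₂ X Z W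
  right Y := isTensor₁_riem₄ X Y Z

theorem riemannTensor_apply (X Y Z W : SmoothField I M) (x : M) :
    riemannTensor x (X x) (Y x) (Z x) (W x) = riem X Y Z W x := by
  obtain ⟨X', hX⟩ := exists_smoothField_eventuallyEq_extend (X x)
  obtain ⟨Y', hY⟩ := exists_smoothField_eventuallyEq_extend (Y x)
  obtain ⟨Z', hZ⟩ := exists_smoothField_eventuallyEq_extend (Z x)
  rw [riemannTensor, curvatureOp_eq hX hY hZ]
  have hX := hX.self_of_nhds
  have hY := hY.self_of_nhds
  have hZ := hZ.self_of_nhds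
  rw [extend_apply_self] at hX hY hZ
  change riem X' Y' Z' W x = _
  rw [(isTensor₁_riem₁ Y' Z' W).apply_eq hX, (isTensor₁_riem₂ X Z' W).apply_eq hY,
    (isTensor₁_riem₃ X Y W).apply_eq hZ]

theorem exists_isOrthonormalAt_std (x : M) :
    ∃ A : Fin (finrank ℝ (TangentSpace I x)) → SmoothField I M, IsOrthonormalAt A x ∧
      ∀ i, ∀ᶠ y in 𝓝 x, A i y = extend E (stdOrthonormalBasis ℝ (TangentSpace I x) i) y := by
  choose A hA using fun i ↦
    exists_smoothField_eventuallyEq_extend (stdOrthonormalBasis ℝ (TangentSpace I x) i)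
  exact ⟨A, .of_basis _ fun i ↦ by simpa using (hA i).self_of_nhds, hA⟩

variable {ι : Type*} [Fintype ι]

theorem IsOrthonormalAt.ricciTensor_eq {A : ι → SmoothField I M} {x : M}
    (hA : IsOrthonormalAt A x) (X Y : SmoothField I M) :
    ricciTensor x (X x) (Y x) = ∑ i, riem X (A i) Y (A i) x := by
  obtain ⟨B, hB, hB'⟩ := exists_isOrthonormalAt_std (I := I) x
  have e (i) : stdOrthonormalBasis ℝ (TangentSpace I x) i = B i x := by
    simpa using (hB' i).self_of_nhds.symm
  simp only [ricciTensor, e, riemannTensor_apply]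
  exact hB.trace_eq hA (isTensor₂_riem X Y)

/-- The Ricci tensor of smooth fields. -/
def ric (X Y : SmoothField I M) : SmoothFunction I M where
  val x := ricciTensor x (X x) (Y x)
  property x := by
    -- The bases chosen in the definition need not vary continuously; near `x` they are replaced by
    -- one smooth frame.
    obtain ⟨F, hF⟩ := exists_eventually_isOrthonormalAt (I := I) x
    refine ((∑ i, riem X (F i) Y (F i)).contMDiff x).congr_of_eventuallyEq ?_
    filter_upwards [hF] with y hy
    rw [hy.ricciTensor_eq, SmoothFunction.sum_apply]

theorem ric_apply (X Y : SmoothField I M) (x : M) : ric X Y x = ricciTensor x (X x) (Y x) := rfl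

theorem IsOrthonormalAt.ric_eq {A : ι → SmoothField I M} {x : M}
    (hA : IsOrthonormalAt A x) (X Y : SmoothField I M) :
    ric X Y x = ∑ i, riem X (A i) Y (A i) x := hA.ricciTensor_eq X Y

theorem ric_comm (X Y : SmoothField I M) : ric X Y = ric Y X := by
  ext x
  obtain ⟨F, hF⟩ := exists_eventually_isOrthonormalAt (I := I) x
  rw [hF.self_of_nhds.ric_eq, hF.self_of_nhds.ric_eq]
  exact Finset.sum_congr rfl fun i _ ↦ by rw [riem_pair]

theorem isTensor₁_ric (X : SmoothField I M) : IsTensor₁ (ric X) where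
  add Y Y' := by
    ext x
    obtain ⟨F, hF⟩ := exists_eventually_isOrthonormalAt (I := I) x
    simp only [hF.self_of_nhds.ric_eq, ContMDiffMap.coe_add, Pi.add_apply,
      ← Finset.sum_add_distrib, (isTensor₁_riem₃ _ _ _).add]
  smul f Y := by
    ext x
    obtain ⟨F, hF⟩ := exists_eventually_isOrthonormalAt (I := I) x
    simp only [hF.self_of_nhds.ric_eq, ContMDiffMap.coe_mul, Pi.mul_apply, Finset.mul_sum,
      (isTensor₁_riem₃ _ _ _).smul]

theorem isTensor₂_ric : IsTensor₂ (ric : SmoothField I M → SmoothField I M → _) where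
  left Y := by simpa only [ric_comm _ Y] using isTensor₁_ric Y
  right X := isTensor₁_ric X

theorem IsOrthonormalAt.scalarCurvature_eq {A : ι → SmoothField I M} {x : M}
    (hA : IsOrthonormalAt A x) : scalarCurvature I x = ∑ i, ric (A i) (A i) x := by
  obtain ⟨B, hB, hB'⟩ := exists_isOrthonormalAt_std (I := I) x
  have e (i) : stdOrthonormalBasis ℝ (TangentSpace I x) i = B i x := by
    simpa using (hB' i).self_of_nhds.symm
  simp only [scalarCurvature, e]
  exact hB.trace_eq hA isTensor₂_ric

variable (I M) in
/-- The scalar curvature as a smooth function. -/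
def scal : SmoothFunction I M where
  val := scalarCurvature I
  property x := by
    obtain ⟨F, hF⟩ := exists_eventually_isOrthonormalAt (I := I) x
    refine ((∑ i, ric (F i) (F i)).contMDiff x).congr_of_eventuallyEq ?_
    filter_upwards [hF] with y hy
    rw [hy.scalarCurvature_eq, SmoothFunction.sum_apply]

theorem scal_apply (x : M) : scal I M x = scalarCurvature I x := rfl

theorem dir_const_smul (X : SmoothField I M) (c : ℝ) (f : SmoothFunction I M) :
    dir X (c • f) = c • dir X f := by
  ext x
  have h := mvfderiv_mul (I := I) (f := fun _ : M ↦ c) (x := x) mdifferentiableAt_const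
    f.mdifferentiableAt
  have e : ((c • f : SmoothFunction I M) : M → ℝ) = (fun _ : M ↦ c) * f := rfl
  simp only [dir_apply, e, h, ContMDiffMap.coe_smul, Pi.smul_apply]
  simp [mvfderiv_const]

/-- The additive map `f ↦ X f`. -/
def dirHom (X : SmoothField I M) : SmoothFunction I M →+ SmoothFunction I M :=
  AddMonoidHom.mk' (dir X) (dir_add X)

@[simp]
theorem dir_neg (X : SmoothField I M) (f : SmoothFunction I M) : dir X (-f) = -dir X f :=
  map_neg (dirHom X) f

@[simp]
theorem dir_sub (X : SmoothField I M) (f g : SmoothFunction I M) :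
    dir X (f - g) = dir X f - dir X g :=
  map_sub (dirHom X) f g

/-- The Kulkarni-Nomizu product of two bilinear tensors. -/
def kn (h k : SmoothField I M → SmoothField I M → SmoothFunction I M)
    (A B C D : SmoothField I M) : SmoothFunction I M :=
  h A C * k B D + h B D * k A C - h A D * k B C - h B C * k A D

/-- The Weyl tensor of smooth fields. -/
def weyl (A B C D : SmoothField I M) : SmoothFunction I M :=
  riem A B C D - (1 / ((finrank ℝ E : ℝ) - 2)) • kn ric ip A B C D
    + (1 / (2 * ((finrank ℝ E : ℝ) - 1) * ((finrank ℝ E : ℝ) - 2))) • (scal I M * kn ip ip A B C D)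

theorem weylTensor_apply (A B C D : SmoothField I M) (x : M) :
    weylTensor x (A x) (B x) (C x) (D x) = weyl A B C D x := by
  rw [weylTensor, riemannTensor_apply]
  simp only [weyl, kn, kulkarniNomizu, ContMDiffMap.coe_add, ContMDiffMap.coe_sub,
    ContMDiffMap.coe_smul, ContMDiffMap.coe_mul, Pi.add_apply, Pi.sub_apply, Pi.smul_apply,
    Pi.mul_apply, smul_eq_mul, ric_apply, ip_apply, scal_apply]
  ring

/-- The covariant derivative of a quadrilinear tensor. -/
def nabla₄ (T : SmoothField I M → SmoothField I M → SmoothField I M → SmoothField I M →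
    SmoothFunction I M) (V A B C D : SmoothField I M) : SmoothFunction I M :=
  dir V (T A B C D) - T (nabla V A) B C D - T A (nabla V B) C D - T A B (nabla V C) D
    - T A B C (nabla V D)

theorem covDerivTensor_weylTensor {x : M} {a b c d : TangentSpace I x} {A B C D : SmoothField I M}
    (V : SmoothField I M)
    (hA : ∀ᶠ y in 𝓝 x, A y = extend E a y) (hB : ∀ᶠ y in 𝓝 x, B y = extend E b y)
    (hC : ∀ᶠ y in 𝓝 x, C y = extend E c y) (hD : ∀ᶠ y in 𝓝 x, D y = extend E d y) :
    covDerivTensor weylTensor x (V x) a b c d = nabla₄ weyl V A B C D x := by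
  have e : (fun y ↦ weylTensor y (extend E a y) (extend E b y) (extend E c y) (extend E d y))
      =ᶠ[𝓝 x] weyl A B C D := by
    filter_upwards [hA, hB, hC, hD] with y h1 h2 h3 h4
    rw [← weylTensor_apply, h1, h2, h3, h4]
  have e' : mvfderiv I (fun y ↦ weylTensor y (extend E a y) (extend E b y) (extend E c y)
      (extend E d y)) x (V x) = dir V (weyl A B C D) x := by
    simp only [dir_apply, mvfderiv, e.mfderiv_eq]
    rfl
  have ha : A x = a := by simpa using hA.self_of_nhds
  have hb : B x = b := by simpa using hB.self_of_nhds
  have hc : C x = c := by simpa using hC.self_of_nhds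
  have hd : D x = d := by simpa using hD.self_of_nhds
  rw [covDerivTensor, e', leviCivita_congr A hA, leviCivita_congr B hB, leviCivita_congr C hC,
    leviCivita_congr D hD, ← nabla_apply, ← nabla_apply, ← nabla_apply, ← nabla_apply,
    ← ha, ← hb, ← hc, ← hd]
  simp only [weylTensor_apply]
  rfl

/-- The metric is parallel, so the derivative falls only on the curvature, the Ricci tensor and the
scalar curvature. -/
theorem nabla₄_weyl (V A B C D : SmoothField I M) :
    nabla₄ weyl V A B C D = nabla₄ riem V A B C D
      - (1 / ((finrank ℝ E : ℝ) - 2)) • kn (nabla₂ ric V) ip A B C D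
      + (1 / (2 * ((finrank ℝ E : ℝ) - 1) * ((finrank ℝ E : ℝ) - 2))) •
        (dir V (scal I M) * kn ip ip A B C D) := by
  simp only [nabla₄, weyl, nabla₂, kn, dir_add, dir_sub, dir_mul, dir_const_smul, dir_ip]
  ext x
  simp only [ContMDiffMap.coe_add, ContMDiffMap.coe_sub,
    ContMDiffMap.coe_smul, ContMDiffMap.coe_mul, Pi.add_apply, Pi.sub_apply, Pi.smul_apply,
    Pi.mul_apply, smul_eq_mul]
  ring

end SmoothField

end CurvatureTensors

/-! ### Contracted Bianchi identities and the divergence of the Weyl tensor. -/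

noncomputable section ContractedBianchi

open Filter Topology InnerProductSpace Module

variable {E : Type*} [NormedAddCommGroup E] [NormedSpace ℝ E]
  {H : Type*} [TopologicalSpace H] {I : ModelWithCorners ℝ E H}
  {M : Type*} [TopologicalSpace M] [ChartedSpace H M] [IsManifold I ∞ M]
  [FiniteDimensional ℝ E] [CompleteSpace E] [T2Space M]
  [RiemannianBundle (fun x : M ↦ TangentSpace I x)]
  [IsContMDiffRiemannianBundle I ∞ E (fun x : M ↦ TangentSpace I x)]

namespace SmoothField

theorem nabla₄_riem_eq (V X Y Z W : SmoothField I M) :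
    nabla₄ riem V X Y Z W = ip (nablaCurv V X Y Z) W := by
  simp only [nabla₄, riem, nablaCurv, dir_ip, ip_sub_left]
  ring

theorem nabla₄_riem_cyclic (V X Y Z W : SmoothField I M) :
    nabla₄ riem V X Y Z W + nabla₄ riem X Y V Z W + nabla₄ riem Y V X Z W = 0 := by
  simp only [nabla₄_riem_eq]
  rw [← ip_add_left, ← ip_add_left, nablaCurv_cyclic]
  ext x
  simp [ip_apply]

theorem nabla₄_riem_swap_left (V X Y Z W : SmoothField I M) :
    nabla₄ riem V X Y Z W = -nabla₄ riem V Y X Z W := by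
  simp only [nabla₄, riem_swap_left X Y, riem_swap_left (nabla V X) Y,
    riem_swap_left X (nabla V Y), dir_neg]
  ring

theorem nabla₄_riem_swap_right (V X Y Z W : SmoothField I M) :
    nabla₄ riem V X Y Z W = -nabla₄ riem V X Y W Z := by
  simp only [nabla₄, riem_swap_right _ _ Z W, riem_swap_right _ _ (nabla V Z) W,
    riem_swap_right _ _ Z (nabla V W), dir_neg]
  ring

theorem nabla₄_riem_pair (V X Y Z W : SmoothField I M) :
    nabla₄ riem V X Y Z W = nabla₄ riem V Z W X Y := by
  simp only [nabla₄, riem_pair X Y, riem_pair (nabla V X) Y, riem_pair X (nabla V Y)]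
  ring

theorem nabla₂_ric_comm (V X Y : SmoothField I M) : nabla₂ ric V X Y = nabla₂ ric V Y X := by
  simp only [nabla₂, ric_comm X, ric_comm (nabla V X)]
  ring

variable {ι : Type*} [Fintype ι] {A : ι → SmoothField I M} {x : M}

/-- Covariant differentiation commutes with the trace over the second and fourth slots. -/
theorem IsOrthonormalAt.nabla₂_ric_eq (hA : IsOrthonormalAt A x) (V X Y : SmoothField I M) :
    nabla₂ ric V X Y x = ∑ i, nabla₄ riem V X (A i) Y (A i) x := by
  have h := hA.dir_trace (isTensor₂_riem X Y) (τ := ric X Y) (fun y F hF ↦ hF.ric_eq X Y) V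
  simp only [nabla₂, ContMDiffMap.coe_sub, Pi.sub_apply, h, hA.ric_eq]
  rw [← Finset.sum_sub_distrib, ← Finset.sum_sub_distrib]
  refine Finset.sum_congr rfl fun i _ ↦ ?_
  simp only [nabla₄, ContMDiffMap.coe_sub, Pi.sub_apply]
  ring

theorem IsOrthonormalAt.dir_scal (hA : IsOrthonormalAt A x) (V : SmoothField I M) :
    dir V (scal I M) x = ∑ i, nabla₂ ric V (A i) (A i) x :=
  hA.dir_trace isTensor₂_ric (fun _ _ hF ↦ hF.scalarCurvature_eq) V

/-- The contracted second Bianchi identity. -/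
theorem IsOrthonormalAt.sum_nabla₄_riem (hA : IsOrthonormalAt A x) (X Y Z : SmoothField I M) :
    ∑ i, nabla₄ riem (A i) (A i) X Y Z x = nabla₂ ric Y Z X x - nabla₂ ric Z Y X x := by
  rw [hA.nabla₂_ric_eq, hA.nabla₂_ric_eq, ← Finset.sum_sub_distrib]
  refine Finset.sum_congr rfl fun i _ ↦ ?_
  -- Pair symmetry moves the traced index out of the first pair, so that the second Bianchi identity
  -- can rotate the differentiation index with `Y, Z`.
  rw [nabla₄_riem_pair]
  have h := congrArg (fun f : SmoothFunction I M ↦ f x) (nabla₄_riem_cyclic (A i) Y Z (A i) X)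
  rw [nabla₄_riem_swap_right Y Z (A i), nabla₄_riem_swap_right Z (A i) Y,
    nabla₄_riem_swap_left Z (A i) Y] at h
  simp only [ContMDiffMap.coe_add, ContMDiffMap.coe_neg, Pi.add_apply, Pi.neg_apply,
    ContMDiffMap.coe_zero, Pi.zero_apply] at h
  linarith

/-- The divergence of the Ricci tensor is half the derivative of the scalar curvature. -/
theorem IsOrthonormalAt.sum_nabla₂_ric (hA : IsOrthonormalAt A x) (Y : SmoothField I M) :
    ∑ i, nabla₂ ric (A i) (A i) Y x = dir Y (scal I M) x / 2 := by
  -- Tracing the contracted identity once more makes the divergence equal to `ds(Y)` minus itself,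
  -- whence the factor `1/2`.
  have h : ∑ i, nabla₂ ric (A i) (A i) Y x
      = dir Y (scal I M) x - ∑ i, nabla₂ ric (A i) (A i) Y x := by
    calc ∑ i, nabla₂ ric (A i) (A i) Y x
        = ∑ i, ∑ j, nabla₄ riem (A i) (A i) (A j) Y (A j) x :=
          Finset.sum_congr rfl fun i _ ↦ hA.nabla₂_ric_eq _ _ _
      _ = ∑ j, ∑ i, nabla₄ riem (A i) (A i) (A j) Y (A j) x := Finset.sum_comm
      _ = ∑ j, (nabla₂ ric Y (A j) (A j) x - nabla₂ ric (A j) Y (A j) x) :=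
          Finset.sum_congr rfl fun j _ ↦ hA.sum_nabla₄_riem _ _ _
      _ = _ := by
        rw [Finset.sum_sub_distrib, ← hA.dir_scal]
        simp only [nabla₂_ric_comm _ Y]
  linarith

theorem isTensor₁_nabla₂_ric (X Y : SmoothField I M) : IsTensor₁ (fun V ↦ nabla₂ ric V X Y) where
  add V W := by
    simp only [nabla₂, dir_add_left, nabla_add_left, (isTensor₂_ric.left _).add,
      (isTensor₂_ric.right _).add]
    ring
  smul f V := by
    simp only [nabla₂, dir_smul_left, nabla_smul_left, (isTensor₂_ric.left _).smul,
      (isTensor₂_ric.right _).smul]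
    ring

theorem isTensor₁_dir (f : SmoothFunction I M) :
    IsTensor₁ (fun V : SmoothField I M ↦ dir V f) where
  add V W := dir_add_left V W f
  smul g V := dir_smul_left g V f

/-- The divergence of the Weyl tensor in terms of the Cotton tensor. -/
theorem IsOrthonormalAt.sum_nabla₄_weyl (hA : IsOrthonormalAt A x) (hdim : 3 ≤ finrank ℝ E)
    (U V N : SmoothField I M) :
    ∑ i, nabla₄ weyl (A i) (A i) U V N x =
      ((finrank ℝ E : ℝ) - 3) / ((finrank ℝ E : ℝ) - 2) *
        (nabla₂ ric V N U x - nabla₂ ric N V U x - 1 / (2 * ((finrank ℝ E : ℝ) - 1)) *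
          (dir V (scal I M) x * ip U N x - dir N (scal I M) x * ip U V x)) := by
  have hn : (3 : ℝ) ≤ finrank ℝ E := by exact_mod_cast hdim
  -- Two of the four terms are divergences of the Ricci tensor, each giving `ds/2`; in the other two
  -- the metric factor collapses the sum.
  have h1 : ∑ i, kn (nabla₂ ric (A i)) ip (A i) U V N x =
      dir V (scal I M) x / 2 * ip U N x + nabla₂ ric V N U x
        - dir N (scal I M) x / 2 * ip U V x - nabla₂ ric N V U x := by
    rw [← hA.sum_nabla₂_ric, ← hA.sum_nabla₂_ric, ← hA.sum_mul (isTensor₁_nabla₂_ric N U) V,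
      ← hA.sum_mul (isTensor₁_nabla₂_ric V U) N, Finset.sum_mul, Finset.sum_mul,
      ← Finset.sum_add_distrib, ← Finset.sum_sub_distrib, ← Finset.sum_sub_distrib]
    refine Finset.sum_congr rfl fun i _ ↦ ?_
    simp only [kn, ContMDiffMap.coe_add, ContMDiffMap.coe_sub, ContMDiffMap.coe_mul,
      Pi.add_apply, Pi.sub_apply, Pi.mul_apply]
    rw [nabla₂_ric_comm _ U N, nabla₂_ric_comm _ U V, ip_comm (A i) V, ip_comm (A i) N,
      ip_apply V, ip_apply N]
    ring
  have h2 : ∑ i, dir (A i) (scal I M) x * kn ip ip (A i) U V N x =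
      2 * (dir V (scal I M) x * ip U N x - dir N (scal I M) x * ip U V x) := by
    rw [← hA.sum_mul (isTensor₁_dir (scal I M)) V, ← hA.sum_mul (isTensor₁_dir (scal I M)) N,
      Finset.sum_mul, Finset.sum_mul, ← Finset.sum_sub_distrib, Finset.mul_sum]
    refine Finset.sum_congr rfl fun i _ ↦ ?_
    simp only [kn, ContMDiffMap.coe_add, ContMDiffMap.coe_sub, ContMDiffMap.coe_mul,
      Pi.add_apply, Pi.sub_apply, Pi.mul_apply]
    rw [ip_comm (A i) V, ip_comm (A i) N, ip_apply V, ip_apply N]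
    ring
  simp only [nabla₄_weyl, ContMDiffMap.coe_add, ContMDiffMap.coe_sub, ContMDiffMap.coe_smul,
    ContMDiffMap.coe_mul, Pi.add_apply, Pi.sub_apply, Pi.smul_apply, Pi.mul_apply, smul_eq_mul]
  rw [Finset.sum_add_distrib, Finset.sum_sub_distrib, ← Finset.mul_sum, ← Finset.mul_sum,
    hA.sum_nabla₄_riem, h1, h2]
  have h3 : (finrank ℝ E : ℝ) - 1 ≠ 0 := by linarith
  -- The coefficients combine as `1 - 1/(n-2) = (n-3)/(n-2)` and `-1/(2(n-2)) + 1/((n-1)(n-2)) =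
  -- -(n-3)/(2(n-1)(n-2))`.
  have h4 : (finrank ℝ E : ℝ) - 2 ≠ 0 := by linarith
  field_simp
  ring

/-! ### Gradient Ricci solitons with weakly harmonic Weyl tensor. -/

/-- The soliton equation on smooth fields. -/
theorem ric_eq_of_soliton {f : SmoothFunction I M} {ρ : ℝ} (hf : IsGradientRicciSoliton I f ρ)
    (X Y : SmoothField I M) : ric X Y = ρ • ip X Y - ip (nabla X (grad f)) Y := by
  ext x
  exact eq_sub_of_add_eq (hf.2 x (X x) (Y x))

/-- The term `ρ g` is parallel, so only the Hessian contributes; its antisymmetrized derivative is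
the commutator of second derivatives of `∇f`, by torsion-freeness. -/
theorem nabla₂_ric_sub_of_soliton {f : SmoothFunction I M} {ρ : ℝ}
    (hf : IsGradientRicciSoliton I f ρ) (X Y Z : SmoothField I M) :
    nabla₂ ric Y Z X - nabla₂ ric Z Y X = riem Y Z (grad f) X := by
  simp only [nabla₂, ric_eq_of_soliton hf, dir_sub, dir_const_smul, dir_ip, smul_add, riem, curv,
    ← nabla_sub_nabla_swap, nabla_sub_left, ip_add_left, ip_sub_left]
  ext x
  simp only [ContMDiffMap.coe_add, ContMDiffMap.coe_sub, ContMDiffMap.coe_smul, Pi.add_apply,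
    Pi.sub_apply, Pi.smul_apply]
  ring

/-- On a gradient Ricci soliton, `½ ∇s = r(∇f)`. -/
theorem dir_scal_of_soliton {f : SmoothFunction I M} {ρ : ℝ}
    (hf : IsGradientRicciSoliton I f ρ) (Y : SmoothField I M) (x : M) :
    dir Y (scal I M) x = 2 * ric Y (grad f) x := by
  obtain ⟨A, hA, -⟩ := exists_isOrthonormalAt_std (I := I) x
  -- Tracing the curvature identity gives `r(Y,∇f)`; the left side is `ds(Y) - ds(Y)/2`.
  have h : ∑ i, (nabla₂ ric Y (A i) (A i) x - nabla₂ ric (A i) (A i) Y x) = ric Y (grad f) x := by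
    rw [hA.ric_eq]
    refine Finset.sum_congr rfl fun i _ ↦ ?_
    rw [← nabla₂_ric_sub_of_soliton hf, nabla₂_ric_comm (A i) Y]
    rfl
  rw [Finset.sum_sub_distrib, ← hA.dir_scal, hA.sum_nabla₂_ric] at h
  linarith

/-- This is `ds ∧ df = 0`: in the identity `key`, every term except `ds(V)⟨U,∇f⟩` is symmetric in
`U, V`, so that one is too. -/
theorem dir_scal_mul_of_weaklyHarmonic {f : SmoothFunction I M} {ρ : ℝ}
    (hf : IsGradientRicciSoliton I f ρ) (hW : IsWeaklyHarmonicWeyl I f)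
    (hdim : 4 ≤ finrank ℝ E) (x : M) (u v : TangentSpace I x) :
    mvfderiv I (scalarCurvature I) x v * inner ℝ u (gradientField I f x) =
      mvfderiv I (scalarCurvature I) x u * inner ℝ v (gradientField I f x) := by
  obtain ⟨A, hA, hA'⟩ := exists_isOrthonormalAt_std (I := I) x
  -- `N` has the germ used by `covDerivTensor` and agrees with `grad f` only at `x`; tensoriality of
  -- the curvature makes that enough.
  obtain ⟨N, hN⟩ := exists_smoothField_eventuallyEq_extend (gradientField I f x)
  have hNx : N x = grad f x := by rw [grad_apply]; simpa using hN.self_of_nhds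
  have hn : (4 : ℝ) ≤ finrank ℝ E := by exact_mod_cast hdim
  have key (u v : TangentSpace I x) (U V : SmoothField I M)
      (hU : ∀ᶠ y in 𝓝 x, U y = extend E u y) (hV : ∀ᶠ y in 𝓝 x, V y = extend E v y) :
      riem V (grad f) (grad f) U x = 1 / (2 * ((finrank ℝ E : ℝ) - 1)) *
        (dir V (scal I M) x * ip U N x - dir N (scal I M) x * ip U V x) := by
    have h := hW x u v
    have e (i) : stdOrthonormalBasis ℝ (TangentSpace I x) i = A i x := by
      simpa using (hA' i).self_of_nhds.symm
    have h1 (i) : covDerivTensor weylTensor x (stdOrthonormalBasis ℝ (TangentSpace I x) i)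
        (stdOrthonormalBasis ℝ (TangentSpace I x) i) u v (gradientField I f x) =
        nabla₄ weyl (A i) (A i) U V N x := by
      rw [← covDerivTensor_weylTensor (A i) (hA' i) hU hV hN, e]
    rw [divTensor, neg_eq_zero, Finset.sum_congr rfl fun i _ ↦ h1 i,
      hA.sum_nabla₄_weyl (by omega)] at h
    -- Dimension at least four enters here: in dimension three this factor vanishes and the
    -- divergence carries no information.
    have h2 : ((finrank ℝ E : ℝ) - 3) / ((finrank ℝ E : ℝ) - 2) ≠ 0 :=
      div_ne_zero (by linarith) (by linarith)
    have h3 := (mul_eq_zero.1 h).resolve_left h2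
    have h4 := congrArg (fun g : SmoothFunction I M ↦ g x) (nabla₂_ric_sub_of_soliton hf U V N)
    simp only [ContMDiffMap.coe_sub, Pi.sub_apply] at h4
    rw [h4, (isTensor₁_riem₂ V (grad f) U).apply_eq hNx] at h3
    linarith
  obtain ⟨U, hU⟩ := exists_smoothField_eventuallyEq_extend u
  obtain ⟨V, hV⟩ := exists_smoothField_eventuallyEq_extend v
  have hUx : U x = u := by simpa using hU.self_of_nhds
  have hVx : V x = v := by simpa using hV.self_of_nhds
  have h1 := key u v U V hU hV
  have h2 := key v u V U hV hU
  have h3 : riem V (grad f) (grad f) U = riem U (grad f) (grad f) V := by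
    rw [riem_pair, riem_swap_left, riem_swap_right, neg_neg]
  rw [h3, h2, ip_comm V U] at h1
  have h4 : 1 / (2 * ((finrank ℝ E : ℝ) - 1)) ≠ 0 :=
    one_div_ne_zero (mul_ne_zero two_ne_zero (by linarith))
  have h5 := mul_left_cancel₀ h4 h1
  rw [ip_apply V N, ip_apply U N, hNx, hUx, hVx] at h5
  rw [← hUx, ← hVx]
  change dir V (scal I M) x * inner ℝ (U x) (grad f x) =
    dir U (scal I M) x * inner ℝ (V x) (grad f x)
  rw [hUx, hVx]
  linarith

end SmoothField

end ContractedBianchi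

theorem mainTheorem4 {E : Type*} [NormedAddCommGroup E] [NormedSpace ℝ E] [FiniteDimensional ℝ E]
    {H : Type*} [TopologicalSpace H] (I : ModelWithCorners ℝ E H) [I.Boundaryless]
    {M : Type*} [TopologicalSpace M] [ChartedSpace H M] [IsManifold I ∞ M] [T2Space M]
    [RiemannianBundle (fun x : M ↦ TangentSpace I x)]
    [IsContMDiffRiemannianBundle I ∞ E (fun x : M ↦ TangentSpace I x)]
    (hdim : 4 ≤ Module.finrank ℝ E)
    (f : M → ℝ) (ρ : ℝ) (hsol : IsGradientRicciSoliton I f ρ)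
    (hweyl : IsWeaklyHarmonicWeyl I f) :
    MDifferentiable I 𝓘(ℝ) (scalarCurvature I : M → ℝ) ∧
    (∀ (x : M) (X : TangentSpace I x),
      (inner ℝ (gradientField I (scalarCurvature I) x) X : ℝ) • gradientField I f x =
        (inner ℝ (gradientField I f x) X : ℝ) • gradientField I (scalarCurvature I) x) ∧
    (∀ x : M, gradientField I f x ≠ 0 →
      ∀ N : TangentSpace I x, N = ‖gradientField I f x‖⁻¹ • gradientField I f x →
        gradientField I (scalarCurvature I) x = (2 * ricciTensor x N N) • gradientField I f x) := by
  have : CompleteSpace E := FiniteDimensional.complete ℝ E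
  let F : SmoothFunction I M := ⟨f, hsol.1⟩
  have hpar (x : M) (u v : TangentSpace I x) :
      (inner ℝ (gradientField I (scalarCurvature I) x) v : ℝ) * inner ℝ (gradientField I f x) u =
        inner ℝ (gradientField I f x) v *
          inner ℝ (gradientField I (scalarCurvature I) x) u := by
    rw [SmoothField.inner_gradientField (scalarCurvature I),
      SmoothField.inner_gradientField (scalarCurvature I), real_inner_comm, real_inner_comm v,
      mul_comm (inner ℝ v _)]
    exact SmoothField.dir_scal_mul_of_weaklyHarmonic (f := F) hsol hweyl hdim x u v
  have hpar' (x : M) (X : TangentSpace I x) :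
      (inner ℝ (gradientField I (scalarCurvature I) x) X : ℝ) • gradientField I f x =
        (inner ℝ (gradientField I f x) X : ℝ) • gradientField I (scalarCurvature I) x := by
    refine ext_inner_right ℝ fun u ↦ ?_
    rw [real_inner_smul_left, real_inner_smul_left]
    exact hpar x u X
  refine ⟨(SmoothField.scal I M).contMDiff.mdifferentiable (by simp), hpar', ?_⟩
  rintro x hx N rfl
  set g := gradientField I f x with hg
  have hn : ‖g‖ ≠ 0 := norm_ne_zero_iff.2 hx
  have h1 : (inner ℝ (gradientField I (scalarCurvature I) x) g : ℝ) = 2 * ricciTensor x g g := by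
    rw [SmoothField.inner_gradientField]
    exact SmoothField.dir_scal_of_soliton (f := F) hsol (SmoothField.grad F) x
  have h2 : ricciTensor x (‖g‖⁻¹ • g) (‖g‖⁻¹ • g) = ‖g‖⁻¹ * (‖g‖⁻¹ * ricciTensor x g g) := by
    -- The norm is frozen at `x`: a constant function is smooth even if `∇f` vanishes elsewhere, so
    -- bilinearity over functions applies.
    let c : SmoothFunction I M := ⟨fun _ ↦ ‖g‖⁻¹, contMDiff_const⟩
    have h3 := (SmoothField.isTensor₂_ric.left (c • SmoothField.grad F)).smul c (SmoothField.grad F)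
    rw [(SmoothField.isTensor₂_ric.right (SmoothField.grad F)).smul] at h3
    exact congrArg (fun h : SmoothFunction I M ↦ h x) h3
  -- Taking `X = ∇f` in the parallelism gives `⟨∇s,∇f⟩ ∇f = |∇f|² ∇s`, which can be solved for `∇s`.
  have h4 := hpar' x g
  rw [h1, ← hg, real_inner_self_eq_norm_sq] at h4
  have h5 : gradientField I (scalarCurvature I) x =
      (‖g‖ ^ 2)⁻¹ • ((2 * ricciTensor x g g) • g) := by
    rw [h4, smul_smul, inv_mul_cancel₀ (pow_ne_zero 2 hn), one_smul]
  rw [h5, h2, smul_smul]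
  congr 1
  field_simp
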